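/- Let $?:[0,1]\to[0,1]$ be the Minkowski question mark function, i.e. the continuous increasing function with $?(0)=0$, $?(1)=1$ and $?\left(\frac{p+p'}{q+q'}\right)=\frac12\left(?\left(\frac pq\right)+?\left(\frac{p'}{q'}\right)\right)$ whenever $\frac pq<\frac{p'}{q'}$ are consecutive elements of one of the Stern–Brocot sequences $F_0,F_1,\dots$, where $F_0=\left(\frac01,\frac11\right)$ and $F_{n+1}$ is obtained from $F_n$ by inserting the mediant $\frac{p+p'}{q+q'}$ between each two consecutive elements $\frac pq,\frac{p'}{q'}$. For an irrational $x\in(0,1)$ with regular continued fraction expansion $x=[0;a_1,a_2,\dots]$ and an integer $t\ge 0$ put $S_x(t)=a_1+\dots+a_t$. Write $?'(x)=+\infty$ if $\lim_{y\to x}\frac{?(y)-?(x)}{y-x}=+\infty$. Let $\lambda_j=\frac{j+\sqrt{j^2+4}}2$ and $$\kappa_2=\frac{4\log\lambda_5-5\log\lambda_4}{\log\lambda_5-\log\lambda_4-\log\sqrt2}=4.401\ldots$$ Theorem 4. (i) Let $x\in(0,1)$ be irrational with $?'(x)=+\infty$. Then for all sufficiently large integers $t$ (depending on $x$), $$\max_{0\le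 u\le t,\ u\in\mathbb Z}\bigl(\kappa_2u-S_x(u)\bigr)\ge\frac{\sqrt t}{10^8}.$$ (ii) There exists an irrational $x\in(0,1)$, all of whose partial quotients $a_i$ belong to $\{4,5\}$, such that $?'(x)=+\infty$ and, for all sufficiently large integers $t$, $$\kappa_2t-S_x(t)\le200\sqrt t.$$ -/

import Mathlib

open Filter Topology

noncomputable section

namespace Minkowski

/-- The Stern–Brocot (Farey) sequence of level `n`: `farey n j = (p, q)` for the `j`-th fraction
`p / q`, `0 ≤ j ≤ 2 ^ n`, in increasing order. Level `0` is `0/1, 1/1`; level `n + 1` keeps the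
fractions of level `n` (at even positions) and inserts the mediants of consecutive ones (at odd
positions). -/
def farey : ℕ → ℕ → ℕ × ℕ
  | 0, j => if j = 0 then (0, 1) else (1, 1)
  | n + 1, j =>
    if j % 2 = 0 then farey n (j / 2)
    else ((farey n (j / 2)).1 + (farey n (j / 2 + 1)).1,
      (farey n (j / 2)).2 + (farey n (j / 2 + 1)).2)

/-- The Minkowski question mark function. The rules `?(0) = 0`, `?(1) = 1` and
`?((p + p') / (q + q')) = (?(p / q) + ?(p' / q')) / 2` for consecutive fractions assign the value
`j / 2 ^ n` to the `j`-th fraction of level `n`. As `?` is increasing and continuous and these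
fractions are dense, `?(x)` is the supremum of the values assigned to the fractions that are at
most `x`. (It is extended by `0` to the left of `[0, 1]` and by `1` to the right.) -/
def questionMark (x : ℝ) : ℝ :=
  sSup {y : ℝ | ∃ n j : ℕ, j ≤ 2 ^ n ∧ ((farey n j).1 : ℝ) / ((farey n j).2 : ℝ) ≤ x ∧
    y = (j : ℝ) / 2 ^ n}

/-- The derivative of `f` at `x` exists and equals `+∞` (two-sided limit of the difference
quotient). -/
def HasDerivInfty (f : ℝ → ℝ) (x : ℝ) : Prop :=
  Tendsto (fun y => (f y - f x) / (y - x)) (𝓝[≠] x) atTop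

/-- For irrational `x ∈ (0, 1)`, `x = [0; a₁, a₂, …]`, this is the partial quotient
`a_{i + 1}` (as a real number). -/
def partialQuotient (x : ℝ) (i : ℕ) : ℝ :=
  ((GenContFract.of x).partDens.get? i).getD 0

/-- `S_x(t) = a₁ + ⋯ + a_t`. -/
def partialQuotientSum (x : ℝ) (t : ℕ) : ℝ :=
  ∑ i ∈ Finset.range t, partialQuotient x i

/-- `λ_j = (j + √(j² + 4)) / 2`. -/
def lam (j : ℕ) : ℝ := ((j : ℝ) + √((j : ℝ) ^ 2 + 4)) / 2

/-- The constant `κ₂ = 4.401…`. -/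
def kappa2 : ℝ :=
  (4 * Real.log (lam 5) - 5 * Real.log (lam 4)) /
    (Real.log (lam 5) - Real.log (lam 4) - Real.log (√2))

end Minkowski

end

namespace Minkowski

/-! Let q_t be the denominators of the convergents of x, S(t) the digit sums, and call κ₂ t - S(t)
the excess. Consecutive convergents are neighbours at Stern–Brocot level S(t+1) - 1: their distance
is 1/(q_t q_{t+1}), while ? differs by 2^(1 - S(t+1)). Hence ?'(x) = +∞ forces q_t q_{t+1} ≥
2^S(t+1) eventually (`eventually_two_pow_le`); for digits at most 5 it suffices that the ratio of
the two tends to infinity (`hasDerivInfty`).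

A digit a acts on (q_{t+1}, q_t) by a symmetric matrix of norm λ_a, so it adds at most 2 log λ_a - a
log 2 to the logarithm of |(q_{t+1}, q_t)|² / 2^S. On positive integers this function of a lies
below its chord through 4 and 5, which is `slope * (κ₂ - a)`. That logarithm is therefore at most
slope times the excess, minus losses, up to a constant.

For (i), a definite loss occurs whenever two successive digits are not both 4 or both 5
(`energy_le`): other digits lie strictly below the chord, and the matrices of 4 and 5 have different
top eigenvectors. The excess has to pay for these losses, so it is essentially bounded below. If it
also stays far below √t, each of about √t blocks of length about √t contains a loss, since a
constant digit would move the excess by order √t. The total loss is then of order √t, a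
contradiction.

For (ii), the digits with k² ≤ index < (k+1)² are 4s followed by 5s, keeping the excess near 20k at
k². Only the change from 5 back to 4 costs anything, at most 2 per block. The total cost 2k is
beaten by slope · 20k ≥ 4k. -/

/-! ### The numbers λ_j and the chord of 2 log λ_a - a log 2 through 4 and 5. -/

lemma lam_pos (j : ℕ) : 0 < lam j := by
  unfold lam
  have : 0 < √((j : ℝ) ^ 2 + 4) := Real.sqrt_pos.2 (by positivity)
  positivity

lemma lam_sq (j : ℕ) : lam j ^ 2 = j * lam j + 1 := by
  unfold lam
  have : √((j : ℝ) ^ 2 + 4) ^ 2 = (j : ℝ) ^ 2 + 4 := Real.sq_sqrt (by positivity)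
  linear_combination this / 4

lemma le_lam (j : ℕ) : (j : ℝ) ≤ lam j := by
  nlinarith [lam_sq j, lam_pos j]

lemma lam_succ_le (j : ℕ) : lam (j + 1) ≤ lam j + 1 := by
  have h1 := lam_sq j
  have h2 := lam_sq (j + 1)
  have h3 := lam_pos j
  have h4 := lam_pos (j + 1)
  have h5 := le_lam (j + 1)
  push_cast at h2 h5
  by_contra! h
  nlinarith

lemma lam_mono : Monotone lam := by
  refine monotone_nat_of_le_succ fun j => ?_
  have h1 := lam_sq j
  have h2 := lam_sq (j + 1)
  have h3 := lam_pos j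
  have h4 := lam_pos (j + 1)
  have h5 := le_lam j
  push_cast at h2
  by_contra! h
  nlinarith

lemma lam_lt_of_sq {j : ℕ} {b : ℝ} (hb : 0 < b) (h : j * b + 1 < b ^ 2) : lam j < b := by
  by_contra! h'
  nlinarith [lam_sq j, lam_pos j, le_lam j, mul_nonneg (sub_nonneg.2 h') (lam_pos j).le]

lemma lt_lam_of_sq {j : ℕ} {b : ℝ} (hb : 0 < b) (h : b ^ 2 < j * b + 1) : b < lam j := by
  by_contra! h'
  nlinarith [lam_sq j, lam_pos j, le_lam j, mul_nonneg (sub_nonneg.2 h') (lam_pos j).le,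
    mul_nonneg (sub_nonneg.2 h') (sub_nonneg.2 (le_lam j))]

lemma lam_four_bounds : 4.236 < lam 4 ∧ lam 4 < 4.2361 :=
  ⟨lt_lam_of_sq (by norm_num) (by norm_num), lam_lt_of_sq (by norm_num) (by norm_num)⟩

lemma lam_five_bounds : 5.1925 < lam 5 ∧ lam 5 < 5.1926 :=
  ⟨lt_lam_of_sq (by norm_num) (by norm_num), lam_lt_of_sq (by norm_num) (by norm_num)⟩

/-- The slope of the chord of `j ↦ j log 2 - 2 log λ_j` between `4` and `5`. -/
noncomputable def slope : ℝ := Real.log 2 - 2 * (Real.log (lam 5) - Real.log (lam 4))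

/-- The vertical distance of `2 log λ_a - a log 2` from its chord through `4` and `5`. -/
noncomputable def defect (a : ℕ) : ℝ :=
  2 * Real.log (lam a) - a * Real.log 2 - slope * (kappa2 - a)

lemma slope_eq_log : slope = Real.log (2 * lam 4 ^ 2 / lam 5 ^ 2) := by
  have h4 := lam_pos 4
  have h5 := lam_pos 5
  rw [Real.log_div (by positivity) (by positivity), Real.log_mul (by norm_num) (by positivity),
    Real.log_pow, Real.log_pow, slope]
  push_cast
  ring

lemma slope_bounds : 1 / 5 < slope ∧ slope < 1 := by
  obtain ⟨h1, h2⟩ := lam_four_bounds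
  obtain ⟨h3, h4⟩ := lam_five_bounds
  have h5 : 1.32 < 2 * lam 4 ^ 2 / lam 5 ^ 2 := by
    rw [lt_div_iff₀ (by positivity)]; nlinarith
  have h6 : 2 * lam 4 ^ 2 / lam 5 ^ 2 < 2 := by
    rw [div_lt_iff₀ (by positivity)]; nlinarith
  rw [slope_eq_log]
  constructor
  · have := Real.one_sub_inv_le_log_of_pos (x := 2 * lam 4 ^ 2 / lam 5 ^ 2) (by linarith)
    have h7 := inv_anti₀ (by norm_num) h5.le
    norm_num at h7 this ⊢
    linarith
  · have := Real.log_le_sub_one_of_pos (x := 2 * lam 4 ^ 2 / lam 5 ^ 2) (by linarith)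
    linarith

/-- The denominator in `kappa2` is `-slope / 2`, so κ₂ is the zero of the chord. -/
lemma slope_mul_kappa2 : slope * kappa2 = 10 * Real.log (lam 4) - 8 * Real.log (lam 5) := by
  have h := slope_bounds.1
  have h2 : Real.log (√2) = Real.log 2 / 2 := Real.log_sqrt (by norm_num)
  have h3 : Real.log (lam 5) - Real.log (lam 4) - Real.log (√2) = -(slope / 2) := by
    rw [h2, slope]; ring
  rw [kappa2, h3]
  have : slope ≠ 0 := by linarith
  field_simp
  ring

lemma defect_eq (a : ℕ) : defect a =
    2 * (Real.log (lam a) - Real.log (lam 4) -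
      ((a : ℝ) - 4) * (Real.log (lam 5) - Real.log (lam 4))) := by
  rw [defect, mul_sub, slope_mul_kappa2, slope]
  ring

lemma defect_four : defect 4 = 0 := by
  rw [defect_eq]; push_cast; ring

lemma defect_five : defect 5 = 0 := by
  rw [defect_eq]; push_cast; ring

lemma log_le_of_le_mul {x y : ℝ} (hx : 0 < x) (hy : 0 < y) (h : x ≤ 0.98 * y) :
    Real.log x - Real.log y ≤ -(1 / 1000) := by
  rw [← Real.log_div hx.ne' hy.ne']
  have h1 := Real.log_le_sub_one_of_pos (div_pos hx hy)
  have h2 : x / y ≤ 0.98 := by rwa [div_le_iff₀ hy]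
  linarith

/-- For m ≥ 5, λ_{m+1}/λ_m ≤ 1 + 1/λ_5 < 0.98 λ_5/λ_4, so every further digit lowers the defect
again. -/
lemma defect_add_six_le (n : ℕ) : defect (n + 6) ≤ -(1 / 1000) := by
  have key : ∀ m : ℕ, 5 ≤ m → defect (m + 1) ≤ defect m - 1 / 1000 := by
    intro m hm
    obtain ⟨h1, h2⟩ := lam_four_bounds
    obtain ⟨h3, h4⟩ := lam_five_bounds
    have h5 : lam 5 ≤ lam m := lam_mono hm
    have h6 := lam_succ_le m
    have p1 := lam_pos m
    have p2 := lam_pos (m + 1)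
    have p4 := lam_pos 4
    have p5 := lam_pos 5
    have h7 : lam (m + 1) * lam 4 ≤ 0.98 * (lam m * lam 5) := by
      calc lam (m + 1) * lam 4 ≤ (lam m + 1) * 4.2361 := by gcongr
        _ ≤ 0.98 * (lam m * 5.1925) := by linarith
        _ ≤ _ := by gcongr
    have := log_le_of_le_mul (by positivity) (by positivity) h7
    rw [Real.log_mul p2.ne' p4.ne', Real.log_mul p1.ne' p5.ne'] at this
    rw [defect_eq, defect_eq]
    push_cast
    linarith
  induction n with
  | zero => have := key 5 le_rfl; rw [defect_five] at this; simpa using this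
  | succ n ih => have := key (n + 6) (by omega); rw [add_right_comm]; linarith

lemma defect_le {a : ℕ} (ha : 1 ≤ a) (h4 : a ≠ 4) (h5 : a ≠ 5) : defect a ≤ -(1 / 1000) := by
  obtain ⟨b1, b2⟩ := lam_four_bounds
  obtain ⟨b3, b4⟩ := lam_five_bounds
  have p4 := lam_pos 4
  have p5 := lam_pos 5
  have q4 (n : ℕ) : (4.236 : ℝ) ^ n ≤ lam 4 ^ n := by gcongr
  have q5 (n : ℕ) : lam 5 ^ n ≤ (5.1926 : ℝ) ^ n := by gcongr
  obtain h | ⟨n, rfl⟩ : a ≤ 3 ∨ ∃ n, a = n + 6 := by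
    rcases Nat.lt_or_ge a 6 with h | h
    · left; omega
    · right; exact ⟨a - 6, by omega⟩
  swap
  · exact defect_add_six_le n
  -- For a = 4 - n the claim exponentiates to λ_a λ_5^n < λ_4^(n+1) with a factor 0.98 to spare,
  -- which rational bounds decide.
  have main : ∀ n : ℕ, ∀ b : ℝ, lam a ≤ b → b * 5.1926 ^ n ≤ 0.98 * 4.236 ^ (n + 1) →
      ((a : ℝ) = 4 - n) → defect a ≤ -(1 / 1000) := by
    intro n b hb hn hna
    have p := lam_pos a
    have h7 : lam a * lam 5 ^ n ≤ 0.98 * lam 4 ^ (n + 1) := by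
      calc lam a * lam 5 ^ n ≤ b * 5.1926 ^ n := by
            have := q5 n
            have : 0 < b := by linarith
            gcongr
        _ ≤ _ := hn
        _ ≤ _ := by have := q4 (n + 1); linarith
    have := log_le_of_le_mul (by positivity) (by positivity) h7
    rw [Real.log_mul p.ne' (by positivity), Real.log_pow, Real.log_pow] at this
    push_cast at this
    rw [defect_eq, hna]
    linarith
  interval_cases a
  · exact main 3 1.62 (lam_lt_of_sq (by norm_num) (by norm_num)).le (by norm_num) (by norm_num)
  · exact main 2 2.42 (lam_lt_of_sq (by norm_num) (by norm_num)).le (by norm_num) (by norm_num)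
  · exact main 1 3.31 (lam_lt_of_sq (by norm_num) (by norm_num)).le (by norm_num) (by norm_num)

lemma defect_nonpos {a : ℕ} (ha : 1 ≤ a) : defect a ≤ 0 := by
  by_cases h4 : a = 4
  · rw [h4, defect_four]
  by_cases h5 : a = 5
  · rw [h5, defect_five]
  linarith [defect_le ha h4 h5]

/-- The zero defects at 4 and 5 make slope · (κ₂ - 4) and slope · (κ₂ - 5) values of 2 log λ_a - a
log 2, one above 0.1 and one below -0.1; then slope < 1 is used. -/
lemma kappa2_bounds : 4.1 < kappa2 ∧ kappa2 < 4.9 := by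
  obtain ⟨s1, s2⟩ := slope_bounds
  obtain ⟨b1, b2⟩ := lam_four_bounds
  obtain ⟨b3, b4⟩ := lam_five_bounds
  have p4 := lam_pos 4
  have p5 := lam_pos 5
  have e4 := defect_four
  have e5 := defect_five
  rw [defect] at e4 e5
  push_cast at e4 e5
  have h4 : 0.1 < 2 * Real.log (lam 4) - 4 * Real.log 2 := by
    have : 2 * Real.log (lam 4) - 4 * Real.log 2 = Real.log (lam 4 ^ 2 / 2 ^ 4) := by
      rw [Real.log_div (by positivity) (by positivity), Real.log_pow, Real.log_pow]; push_cast; ring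
    rw [this]
    have h : 1.12 < lam 4 ^ 2 / 2 ^ 4 := by
      rw [lt_div_iff₀ (by positivity)]; nlinarith
    have := Real.one_sub_inv_le_log_of_pos (x := lam 4 ^ 2 / 2 ^ 4) (by linarith)
    have h7 := inv_anti₀ (by norm_num) h.le
    norm_num at h7 this ⊢
    linarith
  have h5 : 2 * Real.log (lam 5) - 5 * Real.log 2 < -0.1 := by
    have : 2 * Real.log (lam 5) - 5 * Real.log 2 = Real.log (lam 5 ^ 2 / 2 ^ 5) := by
      rw [Real.log_div (by positivity) (by positivity), Real.log_pow, Real.log_pow]; push_cast; ring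
    rw [this]
    have h : lam 5 ^ 2 / 2 ^ 5 < 0.85 := by
      rw [div_lt_iff₀ (by positivity)]; nlinarith
    have := Real.log_le_sub_one_of_pos (x := lam 5 ^ 2 / 2 ^ 5) (by positivity)
    linarith
  constructor <;> nlinarith

/-! ### Stern–Brocot fractions and the values of ? on them. -/

lemma farey_succ_even (n j : ℕ) : farey (n + 1) (2 * j) = farey n j := by
  simp [farey]

lemma farey_succ_odd (n j : ℕ) : farey (n + 1) (2 * j + 1) =
    ((farey n j).1 + (farey n (j + 1)).1, (farey n j).2 + (farey n (j + 1)).2) := by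
  have h : (2 * j + 1) / 2 = j := by omega
  simp [farey, h]

lemma farey_den_pos (n j : ℕ) : 0 < (farey n j).2 := by
  induction n generalizing j with
  | zero => simp only [farey]; split_ifs <;> simp
  | succ n ih =>
    obtain ⟨i, rfl | rfl⟩ := Nat.even_or_odd' j
    · rw [farey_succ_even]; exact ih i
    · rw [farey_succ_odd]; exact Nat.add_pos_left (ih i) _

lemma farey_det {n j : ℕ} (hj : j < 2 ^ n) :
    (farey n (j + 1)).1 * (farey n j).2 = (farey n j).1 * (farey n (j + 1)).2 + 1 := by
  induction n generalizing j with
  | zero => obtain rfl : j = 0 := by simpa using hj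
            simp [farey]
  | succ n ih =>
    rw [pow_succ] at hj
    obtain ⟨i, rfl | rfl⟩ := Nat.even_or_odd' j
    · have := ih (j := i) (by omega)
      rw [farey_succ_even, farey_succ_odd]
      simp only
      linarith
    · have := ih (j := i) (by omega)
      rw [show 2 * i + 1 + 1 = 2 * (i + 1) by ring, farey_succ_even, farey_succ_odd]
      simp only
      linarith

lemma farey_add (n m j : ℕ) : farey (n + m) (2 ^ m * j) = farey n j := by
  induction m with
  | zero => simp
  | succ m ih => rw [← add_assoc, pow_succ', mul_assoc, farey_succ_even, ih]

/-- The `j`-th fraction of level `n` as a real number. -/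
noncomputable def fareyVal (n j : ℕ) : ℝ := ((farey n j).1 : ℝ) / ((farey n j).2 : ℝ)

lemma fareyVal_lt_succ {n j : ℕ} (hj : j < 2 ^ n) : fareyVal n j < fareyVal n (j + 1) := by
  have h1 : (0 : ℝ) < (farey n j).2 := by exact_mod_cast farey_den_pos n j
  have h2 : (0 : ℝ) < (farey n (j + 1)).2 := by exact_mod_cast farey_den_pos n (j + 1)
  have h3 : ((farey n (j + 1)).1 : ℝ) * (farey n j).2 =
      (farey n j).1 * (farey n (j + 1)).2 + 1 := by exact_mod_cast farey_det hj
  rw [fareyVal, fareyVal, div_lt_div_iff₀ h1 h2]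
  linarith

lemma fareyVal_lt {n i j : ℕ} (hij : i < j) (hj : j ≤ 2 ^ n) : fareyVal n i < fareyVal n j := by
  induction j, hij using Nat.le_induction with
  | base => exact fareyVal_lt_succ hj
  | succ k hk ih => exact (ih (by omega)).trans (fareyVal_lt_succ hj)

lemma fareyVal_le_iff {n i j : ℕ} (hi : i ≤ 2 ^ n) (hj : j ≤ 2 ^ n) :
    fareyVal n i ≤ fareyVal n j ↔ i ≤ j := by
  constructor
  · intro h
    by_contra! h'
    exact absurd (fareyVal_lt h' hi) (not_lt.2 h)
  · intro h
    rcases h.eq_or_lt with rfl | h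
    · rfl
    · exact (fareyVal_lt h hj).le

lemma fareyVal_le_iff' {n m i j : ℕ} (hi : i ≤ 2 ^ n) (hj : j ≤ 2 ^ m) :
    fareyVal n i ≤ fareyVal m j ↔ 2 ^ m * i ≤ 2 ^ n * j := by
  rw [← fareyVal_le_iff (n := n + m)]
  · rw [fareyVal, fareyVal, fareyVal, fareyVal, farey_add, add_comm n m, farey_add]
  · rw [pow_add, mul_comm]; gcongr
  · rw [pow_add]; gcongr

lemma le_one_of_mem_questionMark_set {x y : ℝ} (h : y ∈ {y : ℝ | ∃ n j : ℕ, j ≤ 2 ^ n ∧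
    ((farey n j).1 : ℝ) / ((farey n j).2 : ℝ) ≤ x ∧ y = (j : ℝ) / 2 ^ n}) : y ≤ 1 := by
  obtain ⟨n, j, hj, -, rfl⟩ := h
  rw [div_le_one (by positivity)]
  exact_mod_cast hj

lemma questionMark_mono {x y : ℝ} (hx : 0 ≤ x) (hxy : x ≤ y) :
    questionMark x ≤ questionMark y := by
  apply csSup_le_csSup
  · exact ⟨1, fun z hz => le_one_of_mem_questionMark_set hz⟩
  · exact ⟨0, 0, 0, by simp, by simpa [farey] using hx, by simp⟩
  · rintro z ⟨n, j, hj, h, rfl⟩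
    exact ⟨n, j, hj, h.trans hxy, rfl⟩

lemma questionMark_fareyVal {n j : ℕ} (hj : j ≤ 2 ^ n) :
    questionMark (fareyVal n j) = (j : ℝ) / 2 ^ n := by
  apply IsGreatest.csSup_eq
  refine ⟨⟨n, j, hj, le_rfl, rfl⟩, ?_⟩
  rintro z ⟨m, i, hi, h, rfl⟩
  have := (fareyVal_le_iff' hi hj).1 h
  rw [div_le_div_iff₀ (by positivity) (by positivity)]
  have h2 : (2 : ℝ) ^ n * i ≤ 2 ^ m * j := by exact_mod_cast this
  linarith

/-- `z` is one of the fractions of level `n`. -/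
def IsFarey (n : ℕ) (z : ℝ) : Prop := ∃ j : ℕ, j ≤ 2 ^ n ∧ z = fareyVal n j

lemma IsFarey.mono {n m : ℕ} {z : ℝ} (h : IsFarey n z) (hnm : n ≤ m) : IsFarey m z := by
  obtain ⟨j, hj, rfl⟩ := h
  obtain ⟨k, rfl⟩ := Nat.exists_eq_add_of_le hnm
  refine ⟨2 ^ k * j, ?_, ?_⟩
  · rw [pow_add, mul_comm]; gcongr
  · rw [fareyVal, fareyVal, farey_add]

lemma IsFarey.questionMark_add_le {n : ℕ} {z w : ℝ} (hz : IsFarey n z) (hw : IsFarey n w)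
    (h : z < w) : questionMark z + 1 / 2 ^ n ≤ questionMark w := by
  obtain ⟨i, hi, rfl⟩ := hz
  obtain ⟨j, hj, rfl⟩ := hw
  have hij : i < j := by
    by_contra! h'
    exact absurd ((fareyVal_le_iff hj hi).2 h') (not_le.2 h)
  rw [questionMark_fareyVal hi, questionMark_fareyVal hj, ← add_div]
  gcongr
  exact_mod_cast hij

/-- The pairs `u`, `v` represent consecutive fractions of level `n`. -/
def FareyConsec (n : ℕ) (u v : ℕ × ℕ) : Prop :=
  ∃ j : ℕ, j < 2 ^ n ∧ farey n j = u ∧ farey n (j + 1) = v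

/-- This is how a partial quotient b acts: b successive mediants are taken towards the fixed
endpoint `u`, each raising the level by one. -/
lemma FareyConsec.add_left {n : ℕ} {u v : ℕ × ℕ} (h : FareyConsec n u v) (b : ℕ) :
    FareyConsec (n + b) u (b * u.1 + v.1, b * u.2 + v.2) := by
  induction b with
  | zero => simpa using h
  | succ b ih =>
    obtain ⟨j, hj, h1, h2⟩ := ih
    refine ⟨2 * j, ?_, ?_, ?_⟩
    · rw [← add_assoc, pow_succ]; omega
    · rw [← add_assoc, farey_succ_even, h1]
    · rw [← add_assoc, farey_succ_odd, h1, h2]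
      ext <;> simp only <;> ring

lemma FareyConsec.add_right {n : ℕ} {u v : ℕ × ℕ} (h : FareyConsec n u v) (b : ℕ) :
    FareyConsec (n + b) (b * v.1 + u.1, b * v.2 + u.2) v := by
  induction b with
  | zero => simpa using h
  | succ b ih =>
    obtain ⟨j, hj, h1, h2⟩ := ih
    refine ⟨2 * j + 1, ?_, ?_, ?_⟩
    · rw [← add_assoc, pow_succ]; omega
    · rw [← add_assoc, farey_succ_odd, h1, h2]
      ext <;> simp only <;> ring
    · rw [← add_assoc, show 2 * j + 1 + 1 = 2 * (j + 1) by ring, farey_succ_even, h2]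

lemma FareyConsec.isFarey_left {n : ℕ} {u v : ℕ × ℕ} (h : FareyConsec n u v) :
    IsFarey n ((u.1 : ℝ) / u.2) := by
  obtain ⟨j, hj, rfl, rfl⟩ := h
  exact ⟨j, hj.le, rfl⟩

lemma FareyConsec.isFarey_right {n : ℕ} {u v : ℕ × ℕ} (h : FareyConsec n u v) :
    IsFarey n ((v.1 : ℝ) / v.2) := by
  obtain ⟨j, hj, rfl, rfl⟩ := h
  exact ⟨j + 1, hj, rfl⟩

lemma FareyConsec.questionMark_eq {n : ℕ} {u v : ℕ × ℕ} (h : FareyConsec n u v) :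
    questionMark ((v.1 : ℝ) / v.2) = questionMark ((u.1 : ℝ) / u.2) + 1 / 2 ^ n := by
  obtain ⟨j, hj, rfl, rfl⟩ := h
  change questionMark (fareyVal n (j + 1)) = questionMark (fareyVal n j) + _
  rw [questionMark_fareyVal hj, questionMark_fareyVal hj.le]
  push_cast
  ring

/-! ### Continued fraction expansions and convergents. -/

/-- `x = [0; a 0, a 1, …]` with the tails `X k = [0; a k, a (k + 1), …]`. -/
structure IsExpansion (x : ℝ) (a : ℕ → ℕ) (X : ℕ → ℝ) : Prop where
  zero : X 0 = x
  mem : ∀ k, X k ∈ Set.Ioo (0 : ℝ) 1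
  step : ∀ k, X k * (a k + X (k + 1)) = 1
  pos : ∀ k, 1 ≤ a k

lemma exists_isExpansion {x : ℝ} (hx : Irrational x) (h01 : x ∈ Set.Ioo (0 : ℝ) 1) :
    ∃ a X, IsExpansion x a X := by
  let X : ℕ → ℝ := fun k => Nat.rec x (fun _ y => y⁻¹ - (⌊y⁻¹⌋₊ : ℝ)) k
  have hs : ∀ k, X (k + 1) = (X k)⁻¹ - (⌊(X k)⁻¹⌋₊ : ℝ) := fun k => rfl
  have hI : ∀ k, Irrational (X k) ∧ X k ∈ Set.Ioo (0 : ℝ) 1 := by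
    intro k
    induction k with
    | zero => exact ⟨hx, h01⟩
    | succ k ih =>
      obtain ⟨h1, h2, h3⟩ := ih
      have h4 : Irrational (X (k + 1)) := by
        rw [hs]
        exact (irrational_inv_iff.2 h1).sub_natCast _
      have h5 : 0 ≤ X (k + 1) := by
        rw [hs]
        linarith [Nat.floor_le (inv_pos.2 h2).le]
      refine ⟨h4, lt_of_le_of_ne h5 h4.ne_zero.symm, ?_⟩
      rw [hs]
      linarith [Nat.lt_floor_add_one (X k)⁻¹]
  refine ⟨fun k => ⌊(X k)⁻¹⌋₊, X, rfl, fun k => (hI k).2, fun k => ?_, fun k => ?_⟩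
  · have := (hI k).2.1.ne'
    rw [hs]
    field_simp
    ring
  · rw [Nat.one_le_floor_iff]
    exact (one_le_inv₀ (hI k).2.1).2 (hI k).2.2.le

lemma IsExpansion.stream_succ {x : ℝ} {a : ℕ → ℕ} {X : ℕ → ℝ} (h : IsExpansion x a X) (k : ℕ) :
    GenContFract.IntFractPair.stream x (k + 1) = some ⟨(a k : ℤ), X (k + 1)⟩ := by
  have key : ∀ k, GenContFract.IntFractPair.of (X k)⁻¹ = ⟨(a k : ℤ), X (k + 1)⟩ := by
    intro k
    have h1 : (X k)⁻¹ = X (k + 1) + ((a k : ℤ) : ℝ) := by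
      rw [inv_eq_of_mul_eq_one_right (h.step k)]
      push_cast
      ring
    have h2 : ⌊(X k)⁻¹⌋ = a k := by
      rw [h1, Int.floor_add_intCast, Int.floor_eq_zero_iff.2 ⟨(h.mem _).1.le, (h.mem _).2⟩, zero_add]
    rw [GenContFract.IntFractPair.of, h2, Int.fract, h2, h1, add_sub_cancel_right]
  induction k with
  | zero =>
    have h0 : GenContFract.IntFractPair.of x = ⟨0, X 0⟩ := by
      have : ⌊x⌋ = 0 := by
        rw [← h.zero]; exact Int.floor_eq_zero_iff.2 ⟨(h.mem 0).1.le, (h.mem 0).2⟩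
      rw [GenContFract.IntFractPair.of, Int.fract, this, h.zero]
      simp
    rw [GenContFract.IntFractPair.stream_succ_of_some
      (GenContFract.IntFractPair.stream_zero x) (by rw [h0]; exact (h.mem 0).1.ne'), h0, key]
  | succ k ih =>
    rw [GenContFract.IntFractPair.stream_succ_of_some ih (h.mem _).1.ne', key]

lemma IsExpansion.partialQuotient_eq {x : ℝ} {a : ℕ → ℕ} {X : ℕ → ℝ} (h : IsExpansion x a X)
    (i : ℕ) : partialQuotient x i = a i := by
  have h1 := GenContFract.get?_of_eq_some_of_succ_get?_intFractPair_stream (h.stream_succ i)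
  rw [partialQuotient, GenContFract.partDens, Stream'.Seq.map_get?, h1]
  simp

lemma IsExpansion.irrational {x : ℝ} {a : ℕ → ℕ} {X : ℕ → ℝ} (h : IsExpansion x a X) :
    Irrational x := by
  rintro ⟨q, hq⟩
  obtain ⟨n, hn⟩ := (GenContFract.terminates_iff_rat x).2 ⟨q, hq.symm⟩
  have h1 := GenContFract.get?_of_eq_some_of_succ_get?_intFractPair_stream (h.stream_succ n)
  exact Option.some_ne_none _ (h1.symm.trans hn)

/-- Numerator and denominator of `[0; a 0, …, a (t - 1)]`. -/
def conv (a : ℕ → ℕ) : ℕ → ℕ × ℕ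
  | 0 => (0, 1)
  | 1 => (1, a 0)
  | t + 2 => (a (t + 1) * (conv a (t + 1)).1 + (conv a t).1,
      a (t + 1) * (conv a (t + 1)).2 + (conv a t).2)

/-- The denominators of the convergents. -/
def den (a : ℕ → ℕ) (t : ℕ) : ℕ := (conv a t).2

/-- The convergents as real numbers. -/
noncomputable def convVal (a : ℕ → ℕ) (t : ℕ) : ℝ := ((conv a t).1 : ℝ) / ((conv a t).2 : ℝ)

/-- The sum of the first `t` digits. -/
def digitSum (a : ℕ → ℕ) (t : ℕ) : ℕ := ∑ i ∈ Finset.range t, a i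

lemma digitSum_succ (a : ℕ → ℕ) (t : ℕ) : digitSum a (t + 1) = digitSum a t + a t :=
  Finset.sum_range_succ _ _

lemma IsExpansion.partialQuotientSum_eq {x : ℝ} {a : ℕ → ℕ} {X : ℕ → ℝ} (h : IsExpansion x a X)
    (t : ℕ) : partialQuotientSum x t = digitSum a t := by
  rw [partialQuotientSum, digitSum]
  push_cast
  exact Finset.sum_congr rfl fun i _ => h.partialQuotient_eq i

lemma den_add_two (a : ℕ → ℕ) (t : ℕ) : den a (t + 2) = a (t + 1) * den a (t + 1) + den a t := rfl

section

variable {a : ℕ → ℕ}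

lemma le_den_and_pos (ha : ∀ k, 1 ≤ a k) (t : ℕ) :
    t ≤ den a t ∧ 0 < den a t ∧ t + 1 ≤ den a (t + 1) := by
  induction t with
  | zero => exact ⟨Nat.zero_le _, Nat.one_pos, ha 0⟩
  | succ t ih =>
    refine ⟨ih.2.2, by omega, ?_⟩
    rw [den_add_two]
    nlinarith [ha (t + 1), ih.2.1, ih.2.2]

lemma den_pos (ha : ∀ k, 1 ≤ a k) (t : ℕ) : 0 < den a t := (le_den_and_pos ha t).2.1

lemma succ_le_den_mul_den (ha : ∀ k, 1 ≤ a k) (t : ℕ) : t + 1 ≤ den a t * den a (t + 1) := by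
  nlinarith [den_pos ha t, (le_den_and_pos ha t).2.2]

lemma one_le_digitSum (ha : ∀ k, 1 ≤ a k) (t : ℕ) : 1 ≤ digitSum a (t + 1) := by
  rw [digitSum_succ]
  exact (ha t).trans (Nat.le_add_left _ _)

/-- The first digit starts from 0/1, 1/1 and needs only `a 0 - 1` mediants; each later digit needs
as many as its value. The parity of `t` decides which convergent lies on the left. -/
lemma fareyConsec_conv (ha : ∀ k, 1 ≤ a k) (t : ℕ) :
    (Even t → FareyConsec (digitSum a (t + 1) - 1) (conv a t) (conv a (t + 1))) ∧
    (¬ Even t → FareyConsec (digitSum a (t + 1) - 1) (conv a (t + 1)) (conv a t)) := by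
  induction t with
  | zero =>
    refine ⟨fun _ => ?_, fun h => absurd Even.zero h⟩
    have h0 : FareyConsec 0 (0, 1) (1, 1) := ⟨0, by simp, by simp [farey], by simp [farey]⟩
    have := h0.add_left (a 0 - 1)
    simpa [digitSum, conv, Nat.sub_add_cancel (ha 0)] using this
  | succ t ih =>
    have h1 : digitSum a (t + 1 + 1) - 1 = digitSum a (t + 1) - 1 + a (t + 1) := by
      have := one_le_digitSum ha t
      rw [digitSum_succ]; omega
    rw [Nat.even_add_one, not_not, h1]
    exact ⟨fun h => (ih.2 h).add_left _, fun h => (ih.1 h).add_right _⟩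

lemma isFarey_convVal (ha : ∀ k, 1 ≤ a k) (t : ℕ) :
    IsFarey (digitSum a (t + 1) - 1) (convVal a t) := by
  by_cases h : Even t
  · exact ((fareyConsec_conv ha t).1 h).isFarey_left
  · exact ((fareyConsec_conv ha t).2 h).isFarey_right

lemma FareyConsec.sub_eq {n : ℕ} {u v : ℕ × ℕ} (h : FareyConsec n u v) :
    (v.1 : ℝ) / v.2 - (u.1 : ℝ) / u.2 = 1 / (u.2 * v.2) := by
  obtain ⟨j, hj, rfl, rfl⟩ := h
  have h1 : ((farey n j).2 : ℝ) ≠ 0 := by exact_mod_cast (farey_den_pos n j).ne'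
  have h2 : ((farey n (j + 1)).2 : ℝ) ≠ 0 := by exact_mod_cast (farey_den_pos n (j + 1)).ne'
  have h3 : ((farey n (j + 1)).1 : ℝ) * (farey n j).2 =
      (farey n j).1 * (farey n (j + 1)).2 + 1 := by exact_mod_cast farey_det hj
  field_simp
  linarith

lemma convVal_succ_sub (ha : ∀ k, 1 ≤ a k) {t : ℕ} (ht : Even t) :
    convVal a (t + 1) - convVal a t = 1 / (den a t * den a (t + 1)) :=
  ((fareyConsec_conv ha t).1 ht).sub_eq

lemma convVal_sub_succ (ha : ∀ k, 1 ≤ a k) {t : ℕ} (ht : ¬ Even t) :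
    convVal a t - convVal a (t + 1) = 1 / (den a t * den a (t + 1)) := by
  rw [mul_comm]
  exact ((fareyConsec_conv ha t).2 ht).sub_eq

lemma inv_den_mul_den_lt (ha : ∀ k, 1 ≤ a k) (t : ℕ) :
    (1 : ℝ) / (den a (t + 1) * den a (t + 2)) < 1 / (den a t * den a (t + 1)) := by
  have h0 : (0 : ℝ) < den a t := by exact_mod_cast den_pos ha t
  have h1 : (0 : ℝ) < den a (t + 1) := by exact_mod_cast den_pos ha (t + 1)
  apply one_div_lt_one_div_of_lt (by positivity)
  rw [mul_comm]
  gcongr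
  rw [den_add_two]
  nlinarith [ha (t + 1), den_pos ha (t + 1)]

lemma convVal_lt_add_two (ha : ∀ k, 1 ≤ a k) {t : ℕ} (ht : Even t) :
    convVal a t < convVal a (t + 2) := by
  have h1 := convVal_succ_sub ha ht
  have h2 := convVal_sub_succ ha (t := t + 1) (by simpa [Nat.even_add_one] using ht)
  have := inv_den_mul_den_lt ha t
  rw [← h1] at this
  rw [add_assoc] at h2
  norm_num at h2 this
  linarith

lemma convVal_add_two_lt (ha : ∀ k, 1 ≤ a k) {t : ℕ} (ht : ¬ Even t) :
    convVal a (t + 2) < convVal a t := by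
  have h1 := convVal_sub_succ ha ht
  have h2 := convVal_succ_sub ha (t := t + 1) (by simpa [Nat.even_add_one] using ht)
  have := inv_den_mul_den_lt ha t
  rw [← h1] at this
  rw [add_assoc] at h2
  norm_num at h2 this
  linarith

variable {x : ℝ} {X : ℕ → ℝ}

/-- The tails are the ratios of consecutive approximation errors; the minus sign makes the
convergents alternate around `x`. -/
lemma IsExpansion.error_succ (h : IsExpansion x a X) (t : ℕ) :
    x * den a (t + 1) - (conv a (t + 1)).1 = -(X (t + 1) * (x * den a t - (conv a t).1)) := by
  induction t with
  | zero =>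
    have := h.step 0
    rw [h.zero] at this
    simp only [den, conv]
    push_cast
    linear_combination this
  | succ t ih =>
    have h1 := h.step (t + 1)
    have h2 : X (t + 1) ≠ 0 := (h.mem _).1.ne'
    apply mul_left_cancel₀ h2
    rw [den_add_two, conv]
    push_cast
    linear_combination (x * den a (t + 1) - (conv a (t + 1)).1) * h1 + ih

lemma IsExpansion.error_sign (h : IsExpansion x a X) (t : ℕ) :
    (Even t → 0 < x * den a t - (conv a t).1) ∧ (¬ Even t → x * den a t - (conv a t).1 < 0) := by
  induction t with
  | zero =>
    refine ⟨fun _ => ?_, fun h => absurd Even.zero h⟩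
    have := (h.mem 0).1
    rw [h.zero] at this
    simpa [den, conv] using this
  | succ t ih =>
    have := (h.mem (t + 1)).1
    rw [h.error_succ, Nat.even_add_one, not_not]
    exact ⟨fun h => neg_pos.2 (mul_neg_of_pos_of_neg this (ih.2 h)),
      fun h => neg_neg_of_pos (mul_pos this (ih.1 h))⟩

lemma IsExpansion.convVal_lt (h : IsExpansion x a X) {t : ℕ} (ht : Even t) : convVal a t < x := by
  have h0 : (0 : ℝ) < (conv a t).2 := by exact_mod_cast den_pos h.pos t
  have := (h.error_sign t).1 ht
  rw [den] at this
  rw [convVal, div_lt_iff₀ h0]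
  linarith

lemma IsExpansion.lt_convVal (h : IsExpansion x a X) {t : ℕ} (ht : ¬ Even t) :
    x < convVal a t := by
  have h0 : (0 : ℝ) < (conv a t).2 := by exact_mod_cast den_pos h.pos t
  have := (h.error_sign t).2 ht
  rw [den] at this
  rw [convVal, lt_div_iff₀ h0]
  linarith

lemma IsExpansion.abs_convVal_sub_lt (h : IsExpansion x a X) (t : ℕ) :
    |convVal a t - x| < 1 / (den a t * den a (t + 1)) := by
  rw [abs_lt]
  have h0 : (0 : ℝ) < den a t := by exact_mod_cast den_pos h.pos t
  have h1 : (0 : ℝ) < den a (t + 1) := by exact_mod_cast den_pos h.pos (t + 1)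
  have h2 : (0 : ℝ) < 1 / (den a t * den a (t + 1)) := by positivity
  by_cases ht : Even t
  · have e := convVal_succ_sub h.pos ht
    have i1 := h.convVal_lt ht
    have i2 := h.lt_convVal (t := t + 1) (by simpa [Nat.even_add_one] using ht)
    constructor <;> linarith
  · have e := convVal_sub_succ h.pos ht
    have i1 := h.lt_convVal ht
    have i2 := h.convVal_lt (t := t + 1) (by simpa [Nat.even_add_one] using ht)
    constructor <;> linarith

lemma IsExpansion.tendsto_convVal (h : IsExpansion x a X) :
    Tendsto (convVal a) atTop (𝓝 x) := by
  rw [tendsto_iff_norm_sub_tendsto_zero]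
  refine squeeze_zero (fun _ => norm_nonneg _) (fun t => ?_)
    (tendsto_one_div_add_atTop_nhds_zero_nat (𝕜 := ℝ))
  refine (h.abs_convVal_sub_lt t).le.trans ?_
  apply one_div_le_one_div_of_le (by positivity)
  exact_mod_cast succ_le_den_mul_den h.pos t

/-! ### The derivative of ? in terms of denominators. -/

lemma IsExpansion.eventually_two_pow_le (h : IsExpansion x a X)
    (hd : HasDerivInfty questionMark x) :
    ∀ᶠ t : ℕ in atTop, (2 : ℝ) ^ digitSum a (t + 1) ≤ den a t * den a (t + 1) := by
  -- The bound 2 makes up for the -1 in the level S(t+1) - 1.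
  have h1 := hd.eventually_ge_atTop 2
  have hne : ∀ t, convVal a t ≠ x := fun t => by
    by_cases ht : Even t
    · exact (h.convVal_lt ht).ne
    · exact (h.lt_convVal ht).ne'
  have h2 : Tendsto (convVal a) atTop (𝓝[≠] x) :=
    tendsto_nhdsWithin_iff.2 ⟨h.tendsto_convVal, .of_forall hne⟩
  have h3 := h2.eventually h1
  filter_upwards [h3, (tendsto_add_atTop_nat 1).eventually h3] with t e1 e2
  have p0 : (0 : ℝ) < den a t := by exact_mod_cast den_pos h.pos t
  have p1 : (0 : ℝ) < den a (t + 1) := by exact_mod_cast den_pos h.pos (t + 1)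
  obtain ⟨n, hn⟩ : ∃ n, digitSum a (t + 1) = n + 1 :=
    ⟨_, (Nat.sub_add_cancel (one_le_digitSum h.pos t)).symm⟩
  -- As `x` lies between the two convergents, the bounds on the difference quotients at both add up
  -- to one for the chord joining them.
  have key : 2 * ((1 : ℝ) / (den a t * den a (t + 1))) ≤ 1 / 2 ^ n := by
    have hc := fareyConsec_conv h.pos t
    rw [hn, Nat.add_sub_cancel] at hc
    by_cases ht : Even t
    · have d := convVal_succ_sub h.pos ht
      have i1 := h.convVal_lt ht
      have i2 := h.lt_convVal (t := t + 1) (by simpa [Nat.even_add_one] using ht)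
      rw [le_div_iff_of_neg (by linarith)] at e1
      rw [le_div_iff₀ (by linarith)] at e2
      have e3 := (hc.1 ht).questionMark_eq
      change questionMark (convVal a (t + 1)) = questionMark (convVal a t) + _ at e3
      linarith
    · have d := convVal_sub_succ h.pos ht
      have i1 := h.lt_convVal ht
      have i2 := h.convVal_lt (t := t + 1) (by simpa [Nat.even_add_one] using ht)
      rw [le_div_iff₀ (by linarith)] at e1
      rw [le_div_iff_of_neg (by linarith)] at e2
      have e3 := (hc.2 ht).questionMark_eq
      change questionMark (convVal a t) = questionMark (convVal a (t + 1)) + _ at e3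
      linarith
  rw [mul_one_div, div_le_div_iff₀ (by positivity) (by positivity)] at key
  rw [hn, pow_succ]
  linarith

/-- Four more digits, each at most 5, put the convergents t + 2 and t + 4 into level S(t+1) + 20.
They lie between `y` and `x`, so ? increases from `y` to `x` by at least one step of that level,
while x - y < 1/(q_t q_{t+1}). -/
lemma IsExpansion.le_quotient_of_even (h : IsExpansion x a X) (hb : ∀ k, a k ≤ 5) {t : ℕ} {K y : ℝ}
    (ht : Even t) (hK : 0 ≤ K) (hKt : K * 2 ^ (digitSum a (t + 1) + 20) ≤ den a t * den a (t + 1))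
    (hy0 : 0 ≤ y) (hy1 : convVal a t ≤ y) (hy2 : y < convVal a (t + 2)) :
    K ≤ (questionMark y - questionMark x) / (y - x) := by
  have p0 : (0 : ℝ) < den a t := by exact_mod_cast den_pos h.pos t
  have p1 : (0 : ℝ) < den a (t + 1) := by exact_mod_cast den_pos h.pos (t + 1)
  have hl : digitSum a (t + 5) ≤ digitSum a (t + 1) + 20 := by
    simp only [show t + 5 = t + 1 + 1 + 1 + 1 + 1 by ring, digitSum_succ]
    linarith [hb (t + 1), hb (t + 1 + 1), hb (t + 1 + 1 + 1), hb (t + 1 + 1 + 1 + 1)]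
  have hl' : digitSum a (t + 3) ≤ digitSum a (t + 5) := by
    simp only [show t + 5 = t + 3 + 1 + 1 by ring, digitSum_succ]
    omega
  have ht2 : Even (t + 2) := by simpa [parity_simps] using ht
  have ht4 : Even (t + 4) := by
    rw [Nat.even_add]; exact iff_of_true ht (by decide)
  have f1 : IsFarey (digitSum a (t + 1) + 20) (convVal a (t + 2)) :=
    (isFarey_convVal h.pos (t + 2)).mono ((Nat.sub_le _ 1).trans (hl'.trans hl))
  have f2 : IsFarey (digitSum a (t + 1) + 20) (convVal a (t + 4)) :=
    (isFarey_convVal h.pos (t + 4)).mono ((Nat.sub_le _ 1).trans hl)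
  have g1 := f1.questionMark_add_le f2 (convVal_lt_add_two h.pos ht2)
  have g2 := questionMark_mono hy0 hy2.le
  have g3 := questionMark_mono (hy0.trans (hy2.le.trans (convVal_lt_add_two h.pos ht2).le))
    (h.convVal_lt ht4).le
  have g4 := (abs_lt.1 (h.abs_convVal_sub_lt t)).1
  have g5 := h.convVal_lt ht2
  rw [le_div_iff_of_neg (by linarith)]
  have g6 : K * (1 / (den a t * den a (t + 1))) ≤ 1 / 2 ^ (digitSum a (t + 1) + 20) := by
    rw [mul_one_div, div_le_div_iff₀ (by positivity) (by positivity)]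
    linarith
  have g7 : K * (x - y) ≤ K * (1 / (den a t * den a (t + 1))) := by
    gcongr
    linarith
  linarith

lemma IsExpansion.le_quotient_of_odd (h : IsExpansion x a X) (hb : ∀ k, a k ≤ 5) {t : ℕ} {K y : ℝ}
    (ht : ¬ Even t) (hK : 0 ≤ K)
    (hKt : K * 2 ^ (digitSum a (t + 1) + 20) ≤ den a t * den a (t + 1))
    (hy1 : y ≤ convVal a t) (hy2 : convVal a (t + 2) < y) :
    K ≤ (questionMark y - questionMark x) / (y - x) := by
  have p0 : (0 : ℝ) < den a t := by exact_mod_cast den_pos h.pos t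
  have p1 : (0 : ℝ) < den a (t + 1) := by exact_mod_cast den_pos h.pos (t + 1)
  have hl : digitSum a (t + 5) ≤ digitSum a (t + 1) + 20 := by
    simp only [show t + 5 = t + 1 + 1 + 1 + 1 + 1 by ring, digitSum_succ]
    linarith [hb (t + 1), hb (t + 1 + 1), hb (t + 1 + 1 + 1), hb (t + 1 + 1 + 1 + 1)]
  have hl' : digitSum a (t + 3) ≤ digitSum a (t + 5) := by
    simp only [show t + 5 = t + 3 + 1 + 1 by ring, digitSum_succ]
    omega
  have ht2 : ¬ Even (t + 2) := by simpa [parity_simps] using ht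
  have ht4 : ¬ Even (t + 4) := by
    rw [Nat.even_add]; exact fun h => ht (h.2 (by decide))
  have f1 : IsFarey (digitSum a (t + 1) + 20) (convVal a (t + 2)) :=
    (isFarey_convVal h.pos (t + 2)).mono ((Nat.sub_le _ 1).trans (hl'.trans hl))
  have f2 : IsFarey (digitSum a (t + 1) + 20) (convVal a (t + 4)) :=
    (isFarey_convVal h.pos (t + 4)).mono ((Nat.sub_le _ 1).trans hl)
  have hx : 0 ≤ x := by rw [← h.zero]; exact (h.mem 0).1.le
  have g1 := f2.questionMark_add_le f1 (convVal_add_two_lt h.pos ht2)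
  have g5 := h.lt_convVal ht2
  have g2 := questionMark_mono (hx.trans g5.le) hy2.le
  have g3 := questionMark_mono hx (h.lt_convVal ht4).le
  have g4 := (abs_lt.1 (h.abs_convVal_sub_lt t)).2
  rw [le_div_iff₀ (by linarith)]
  have g6 : K * (1 / (den a t * den a (t + 1))) ≤ 1 / 2 ^ (digitSum a (t + 1) + 20) := by
    rw [mul_one_div, div_le_div_iff₀ (by positivity) (by positivity)]
    linarith
  have g7 : K * (y - x) ≤ K * (1 / (den a t * den a (t + 1))) := by
    gcongr
    linarith
  linarith

lemma exists_consecutive {p : ℕ → Prop} {n m : ℕ} (hn : ¬ p n) (hnm : n ≤ m) (hm : p m) :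
    ∃ k, n ≤ k ∧ ¬ p k ∧ p (k + 1) := by
  by_contra! H
  have : ∀ k, n ≤ k → ¬ p k := fun k hk => by
    induction k, hk using Nat.le_induction with
    | base => exact hn
    | succ k hk ih => exact H k hk ih
  exact this m hnm hm

lemma IsExpansion.hasDerivInfty (h : IsExpansion x a X) (hb : ∀ k, a k ≤ 5)
    (hT : Tendsto (fun t => (den a t * den a (t + 1) : ℝ) / 2 ^ digitSum a (t + 1)) atTop atTop) :
    HasDerivInfty questionMark x := by
  refine tendsto_atTop.2 fun K => ?_
  -- The factor 2^20 covers the 20 extra levels in `le_quotient_of_even` and `le_quotient_of_odd`;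
  -- `|K|` supplies the nonnegativity they need.
  obtain ⟨T, hTK⟩ := eventually_atTop.1 (hT.eventually_ge_atTop (|K| * 2 ^ 20))
  have hKt : ∀ t, T ≤ t →
      |K| * 2 ^ (digitSum a (t + 1) + 20) ≤ den a t * den a (t + 1) := by
    intro t ht
    have := hTK t ht
    rw [le_div_iff₀ (by positivity)] at this
    rw [pow_add, mul_comm (2 ^ _), ← mul_assoc]
    exact this
  have odd_succ : ∀ s, ¬ Even (2 * s + 1) := fun s => by simp [parity_simps]
  have c1 := h.convVal_lt (even_two_mul T)
  have c2 := h.lt_convVal (odd_succ T)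
  have hx0 : 0 < x := by rw [← h.zero]; exact (h.mem 0).1
  have hnhds : Set.Ioo (max 0 (convVal a (2 * T))) (convVal a (2 * T + 1)) ∈ 𝓝 x :=
    Ioo_mem_nhds (max_lt hx0 c1) c2
  have hev : ∀ᶠ s : ℕ in atTop, T ≤ s := eventually_ge_atTop T
  have htwo : Tendsto (fun s : ℕ => 2 * s) atTop atTop :=
    tendsto_id.const_mul_atTop' two_pos
  filter_upwards [nhdsWithin_le_nhds hnhds, self_mem_nhdsWithin] with y hy hyx
  obtain ⟨hy1, hy2⟩ := hy
  obtain ⟨hy0, hy1⟩ := max_lt_iff.1 hy1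
  refine (le_abs_self K).trans ?_
  rcases lt_or_gt_of_ne (show y ≠ x from hyx) with hlt | hgt
  · obtain ⟨m, hm1, hm2⟩ :=
      (((h.tendsto_convVal.comp htwo).eventually_const_lt hlt).and hev).exists
    obtain ⟨s, hs1, hs2, hs3⟩ := exists_consecutive (p := fun s => y < convVal a (2 * s))
      (not_lt.2 hy1.le) hm2 hm1
    exact h.le_quotient_of_even hb (even_two_mul s) (abs_nonneg K) (hKt _ (by omega)) hy0.le
      (not_lt.1 hs2) hs3
  · obtain ⟨m, hm1, hm2⟩ := (((h.tendsto_convVal.comp ((tendsto_add_atTop_nat 1).comp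
      htwo)).eventually_lt_const hgt).and hev).exists
    obtain ⟨s, hs1, hs2, hs3⟩ := exists_consecutive (p := fun s => convVal a (2 * s + 1) < y)
      (not_lt.2 hy2.le) hm2 hm1
    exact h.le_quotient_of_odd hb (odd_succ s) (abs_nonneg K) (hKt _ (by omega))
      (not_lt.1 hs2) hs3

end

/-! ### Energy estimates and the lower bound (i). -/

/-- The logarithm of the squared Euclidean norm of two consecutive denominators. -/
noncomputable def logNormSq (a : ℕ → ℕ) (t : ℕ) : ℝ :=
  Real.log ((den a (t + 1) : ℝ) ^ 2 + (den a t : ℝ) ^ 2)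

/-- The quantity `κ₂ t - S(t)`. -/
noncomputable def excess (a : ℕ → ℕ) (t : ℕ) : ℝ := kappa2 * t - digitSum a t

lemma excess_succ (a : ℕ → ℕ) (t : ℕ) : excess a (t + 1) = excess a t + (kappa2 - a t) := by
  rw [excess, excess, digitSum_succ]
  push_cast
  ring

/-- The matrix with rows (n, 1), (1, 0) is symmetric with eigenvalues λ_n and -1/λ_n. The slack,
times λ_n, is n(u - λ_n v)², which vanishes along the top eigenvector (λ_n, 1). -/
lemma normSq_step_le (n : ℕ) (u v : ℝ) :
    (n * u + v) ^ 2 + u ^ 2 ≤ lam n ^ 2 * (u ^ 2 + v ^ 2) := by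
  have h1 := lam_sq n
  have h2 := lam_pos n
  have h3 : lam n * (lam n ^ 2 * (u ^ 2 + v ^ 2) - ((n * u + v) ^ 2 + u ^ 2)) =
      n * (u - lam n * v) ^ 2 := by
    have h4 : lam n ^ 3 = (n : ℝ) * (n * lam n + 1) + lam n := by
      rw [pow_succ, h1]; linear_combination (n : ℝ) * h1
    linear_combination (u ^ 2 + v ^ 2) * h4 - (n : ℝ) * v ^ 2 * h1
  have h5 : 0 ≤ lam n * (lam n ^ 2 * (u ^ 2 + v ^ 2) - ((n * u + v) ^ 2 + u ^ 2)) := by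
    rw [h3]; positivity
  linarith [nonneg_of_mul_nonneg_right h5 h2]

/-- 483 = 21² + 5² + 4² + 1² is the squared Frobenius norm of the product of the two digit matrices.
It is smaller than (λ_4 λ_5)² ≈ 483.8, whence the loss in `logNormSq_add_two_le`. -/
lemma normSq_switch_le {m n : ℕ} (h : m = 4 ∧ n = 5 ∨ m = 5 ∧ n = 4) (u v : ℝ) :
    (n * (m * u + v) + u) ^ 2 + (m * u + v) ^ 2 ≤ 483 * (u ^ 2 + v ^ 2) := by
  rcases h with ⟨rfl, rfl⟩ | ⟨rfl, rfl⟩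
  · push_cast
    nlinarith [sq_nonneg (u - 4.2 * v)]
  · push_cast
    nlinarith [sq_nonneg (u - 5.2 * v)]

section

variable {a : ℕ → ℕ}

lemma logNormSq_succ_le (ha : ∀ k, 1 ≤ a k) (t : ℕ) :
    logNormSq a (t + 1) ≤ logNormSq a t + 2 * Real.log (lam (a (t + 1))) := by
  have p0 : (0 : ℝ) < den a t := by exact_mod_cast den_pos ha t
  have p1 : (0 : ℝ) < den a (t + 1) := by exact_mod_cast den_pos ha (t + 1)
  have p2 : (0 : ℝ) < den a (t + 2) := by exact_mod_cast den_pos ha (t + 2)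
  have pl := lam_pos (a (t + 1))
  have h := normSq_step_le (a (t + 1)) (den a (t + 1)) (den a t)
  have hd : (den a (t + 2) : ℝ) = a (t + 1) * den a (t + 1) + den a t := by
    rw [den_add_two]; push_cast; rfl
  rw [← hd] at h
  have := Real.log_le_log (by positivity) h
  rw [Real.log_mul (by positivity) (by positivity), Real.log_pow] at this
  rw [logNormSq, logNormSq]
  push_cast at this
  linarith

lemma logNormSq_add_two_le (ha : ∀ k, 1 ≤ a k) (t : ℕ)
    (h45 : a (t + 1) = 4 ∧ a (t + 2) = 5 ∨ a (t + 1) = 5 ∧ a (t + 2) = 4) :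
    logNormSq a (t + 2) ≤ logNormSq a t + 2 * Real.log (lam (a (t + 1))) +
      2 * Real.log (lam (a (t + 2))) - 1 / 1000 := by
  have p0 : (0 : ℝ) < den a t := by exact_mod_cast den_pos ha t
  have p1 : (0 : ℝ) < den a (t + 1) := by exact_mod_cast den_pos ha (t + 1)
  have p2 : (0 : ℝ) < den a (t + 2) := by exact_mod_cast den_pos ha (t + 2)
  have p3 : (0 : ℝ) < den a (t + 3) := by exact_mod_cast den_pos ha (t + 3)
  have p4 := lam_pos 4
  have p5 := lam_pos 5
  have h := normSq_switch_le h45 (den a (t + 1)) (den a t)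
  have hd : (den a (t + 2) : ℝ) = a (t + 1) * den a (t + 1) + den a t := by
    rw [den_add_two]; push_cast; rfl
  have hd' : (den a (t + 3) : ℝ) = a (t + 2) * den a (t + 2) + den a (t + 1) := by
    rw [den_add_two]; push_cast; rfl
  rw [← hd, ← hd'] at h
  have h1 := Real.log_le_log (by positivity) h
  rw [Real.log_mul (by positivity) (by positivity)] at h1
  have h2 : Real.log 483 - (2 * Real.log (lam 4) + 2 * Real.log (lam 5)) ≤ -(1 / 1000) := by
    obtain ⟨b1, b2⟩ := lam_four_bounds
    obtain ⟨b3, b4⟩ := lam_five_bounds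
    have e4 := lam_sq 4
    have e5 := lam_sq 5
    push_cast at e4 e5
    have h3 : 2 * Real.log (lam 4) + 2 * Real.log (lam 5) = Real.log (lam 4 ^ 2 * lam 5 ^ 2) := by
      rw [Real.log_mul (by positivity) (by positivity), Real.log_pow, Real.log_pow]
      push_cast
      ring
    rw [h3, ← Real.log_div (by norm_num) (by positivity)]
    have h4 := Real.log_le_sub_one_of_pos
      (show (0 : ℝ) < 483 / (lam 4 ^ 2 * lam 5 ^ 2) by positivity)
    have h5 : 483 / (lam 4 ^ 2 * lam 5 ^ 2) ≤ 0.999 := by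
      rw [div_le_iff₀ (by positivity), e4, e5]
      nlinarith
    linarith
  rw [logNormSq, logNormSq]
  rcases h45 with ⟨e1, e2⟩ | ⟨e1, e2⟩ <;> rw [e1, e2] <;> linarith

/-- The digits `a (t + 1)` and `a (t + 2)` are both `4` or both `5`. -/
def Steady (a : ℕ → ℕ) (t : ℕ) : Prop := a (t + 1) = a (t + 2) ∧ (a (t + 1) = 4 ∨ a (t + 1) = 5)

instance (a : ℕ → ℕ) : DecidablePred (Steady a) := fun t => by
  unfold Steady; infer_instance

/-- The number of positions before `t` at which the digits are not steady. -/
def unsteadyCount (a : ℕ → ℕ) (t : ℕ) : ℕ := ∑ i ∈ Finset.range t, if Steady a i then 0 else 1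

lemma unsteadyCount_succ (a : ℕ → ℕ) (t : ℕ) :
    unsteadyCount a (t + 1) = unsteadyCount a t + if Steady a t then 0 else 1 :=
  Finset.sum_range_succ _ _

/-- The logarithmic size of the denominators, compared with `2 ^ S(t)` and `excess`. -/
noncomputable def energy (a : ℕ → ℕ) (t : ℕ) : ℝ :=
  logNormSq a t + logNormSq a (t + 1) - Real.log 2 * (digitSum a (t + 1) + digitSum a (t + 2)) -
    slope * (excess a (t + 1) + excess a (t + 2))

lemma energy_le (ha : ∀ k, 1 ≤ a k) (t : ℕ) :
    energy a t ≤ energy a 0 - unsteadyCount a t / 1000 := by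
  induction t with
  | zero => simp [unsteadyCount]
  | succ t ih =>
    -- Since `energy` sums two consecutive terms, its increment contains a two-step increment of
    -- `logNormSq`, which detects a switch between 4 and 5.
    have hE : energy a (t + 1) = energy a t + (logNormSq a (t + 2) - logNormSq a t -
        2 * Real.log (lam (a (t + 1))) - 2 * Real.log (lam (a (t + 2)))) +
        defect (a (t + 1)) + defect (a (t + 2)) := by
      simp only [energy, defect, excess_succ, digitSum_succ]
      push_cast
      ring
    have s1 := logNormSq_succ_le ha t
    have s2 := logNormSq_succ_le ha (t + 1)
    have d1 := defect_nonpos (ha (t + 1))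
    have d2 := defect_nonpos (ha (t + 2))
    simp only [add_assoc, Nat.reduceAdd] at s2
    rw [unsteadyCount_succ]
    by_cases hs : Steady a t
    · rw [if_pos hs]
      push_cast
      linarith
    · rw [if_neg hs]
      push_cast
      by_cases c1 : a (t + 1) = 4 ∨ a (t + 1) = 5
      · by_cases c2 : a (t + 2) = 4 ∨ a (t + 2) = 5
        · have := logNormSq_add_two_le ha t (by unfold Steady at hs; omega)
          linarith
        · have := defect_le (ha (t + 2)) (fun h => c2 (.inl h)) (fun h => c2 (.inr h))
          linarith
      · have := defect_le (ha (t + 1)) (fun h => c1 (.inl h)) (fun h => c1 (.inr h))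
        linarith

lemma neg_slope_mul_le_energy (ha : ∀ k, 1 ≤ a k) {t : ℕ}
    (h : (2 : ℝ) ^ digitSum a (t + 2) ≤ den a (t + 1) * den a (t + 2)) :
    -(slope * (excess a (t + 1) + excess a (t + 2))) ≤ energy a t := by
  have p1 : (0 : ℝ) < den a (t + 1) := by exact_mod_cast den_pos ha (t + 1)
  have p2 : (0 : ℝ) < den a (t + 2) := by exact_mod_cast den_pos ha (t + 2)
  have h1 : 2 * Real.log (den a (t + 1)) ≤ logNormSq a t := by
    rw [← Nat.cast_two, ← Real.log_pow, logNormSq]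
    apply Real.log_le_log (by positivity)
    linarith [sq_nonneg (den a t : ℝ)]
  have h2 : 2 * Real.log (den a (t + 2)) ≤ logNormSq a (t + 1) := by
    rw [← Nat.cast_two, ← Real.log_pow, logNormSq]
    apply Real.log_le_log (by positivity)
    linarith [sq_nonneg (den a (t + 1) : ℝ)]
  have h3 := Real.log_le_log (by positivity) h
  rw [Real.log_pow, Real.log_mul p1.ne' p2.ne'] at h3
  have h4 : 0 < Real.log 2 := Real.log_pos (by norm_num)
  have h5 : (digitSum a (t + 2) : ℝ) = digitSum a (t + 1) + a (t + 1) := by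
    rw [digitSum_succ]; push_cast; rfl
  have h6 : 0 ≤ Real.log 2 * a (t + 1) := by positivity
  have h7 : digitSum a (t + 2) * Real.log 2 =
    Real.log 2 * digitSum a (t + 1) + Real.log 2 * a (t + 1) := by rw [h5]; ring
  rw [energy, h5]
  linarith

/-- A steady run repeats a single digit 4 or 5, and κ₂ is more than 0.1 away from both. Each
position thus moves the sum of two excesses by at least 2 · 0.1, always in the same direction. -/
lemma abs_excess_change_of_steady {u m : ℕ} (h : ∀ i < m, Steady a (u + i)) :
    (m : ℝ) / 5 ≤ |(excess a (u + m + 1) + excess a (u + m + 2)) -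
      (excess a (u + 1) + excess a (u + 2))| := by
  obtain ⟨k1, k2⟩ := kappa2_bounds
  rcases Nat.eq_zero_or_pos m with rfl | hm
  · simp
  have key : ∀ i ≤ m, a (u + i + 1) = a (u + 1) ∧ (excess a (u + i + 1) + excess a (u + i + 2)) -
      (excess a (u + 1) + excess a (u + 2)) = i * (2 * (kappa2 - a (u + 1))) := by
    intro i hi
    induction i with
    | zero => simp
    | succ i ih =>
      obtain ⟨e1, e2⟩ := ih (by omega)
      obtain ⟨s1, s2⟩ := h i (by omega)
      have s3 : a (u + i + 1 + 1) = a (u + 1) := by rw [← e1]; exact s1.symm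
      refine ⟨s3, ?_⟩
      have x1 := excess_succ a (u + i + 1)
      have x2 := excess_succ a (u + i + 1 + 1)
      rw [e1] at x1
      rw [s3] at x2
      simp only [← add_assoc] at *
      norm_num [add_assoc] at *
      linarith
  rw [(key m le_rfl).2, abs_mul, Nat.abs_cast, div_eq_mul_inv]
  gcongr
  rcases (h 0 hm).2 with e | e
  · rw [add_zero] at e
    rw [e]; push_cast
    rw [abs_of_pos (by linarith)]
    linarith
  · rw [add_zero] at e
    rw [e]; push_cast
    rw [abs_of_neg (by linarith)]
    linarith

lemma unsteadyCount_mono (a : ℕ → ℕ) : Monotone (unsteadyCount a) :=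
  monotone_nat_of_le_succ fun t => by rw [unsteadyCount_succ]; omega

lemma steady_or_lt (a : ℕ → ℕ) (u m : ℕ) :
    (∀ i < m, Steady a (u + i)) ∨ unsteadyCount a u + 1 ≤ unsteadyCount a (u + m) := by
  by_contra! H
  obtain ⟨⟨i, hi, hs⟩, h2⟩ := H
  have h3 := unsteadyCount_mono a (show u ≤ u + i by omega)
  have h4 := unsteadyCount_mono a (show u + i + 1 ≤ u + m by omega)
  rw [unsteadyCount_succ, if_neg hs] at h4
  omega

variable {x : ℝ} {X : ℕ → ℝ}

theorem IsExpansion.eventually_exists_sqrt_le (h : IsExpansion x a X)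
    (hd : HasDerivInfty questionMark x) :
    ∀ᶠ t : ℕ in atTop, ∃ u ≤ t, √(t : ℝ) / 10 ^ 8 ≤ excess a u := by
  obtain ⟨c1, c2⟩ := slope_bounds
  obtain ⟨t₀, ht₀⟩ := eventually_atTop.1 (h.eventually_two_pow_le hd)
  set C : ℝ := |energy a 0| with hC
  have hC0 : 0 ≤ C := abs_nonneg _
  have lower : ∀ t, t₀ ≤ t → (unsteadyCount a t : ℝ) / 1000 - C ≤
      slope * (excess a (t + 1) + excess a (t + 2)) := by
    intro t ht
    have h1 := neg_slope_mul_le_energy h.pos (ht₀ (t + 1) (by omega))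
    have h2 := energy_le h.pos t
    have := le_abs_self (energy a 0)
    linarith
  -- For s = ⌊√t⌋ ≥ N, the multiples of C are negligible against s, and t₀ + (s - 1)s + 2 ≤ s² ≤ t
  -- leaves room for s - 1 blocks of length s.
  obtain ⟨N, hN⟩ := exists_nat_ge (10 ^ 4 * (C + 1) + t₀ + 2)
  filter_upwards [eventually_ge_atTop (N * N)] with t ht
  by_contra! H
  set s := Nat.sqrt t with hs
  have hNs : N ≤ s := Nat.le_sqrt.2 ht
  have hs1 : s * s ≤ t := Nat.sqrt_le t
  have hsR : 10 ^ 4 * (C + 1) + t₀ + 2 ≤ (s : ℝ) := hN.trans (by exact_mod_cast hNs)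
  have ht0R : (0 : ℝ) ≤ t₀ := Nat.cast_nonneg _
  have hst : t₀ + 2 ≤ s := by
    have : ((t₀ + 2 : ℕ) : ℝ) ≤ s := by push_cast; linarith
    exact_mod_cast this
  have hsqrt : √(t : ℝ) ≤ 2 * s := by
    rw [Real.sqrt_le_left (by positivity)]
    have h1 : t < (s + 1) * (s + 1) := Nat.lt_succ_sqrt t
    have h2 : (t : ℝ) < (s + 1) * (s + 1) := by exact_mod_cast h1
    nlinarith
  have upper : ∀ u, u + 2 ≤ t →
      excess a (u + 1) + excess a (u + 2) ≤ 4 / 10 ^ 8 * s := by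
    intro u hu
    have h1 := H (u + 1) (by omega)
    have h2 := H (u + 2) (by omega)
    have h3 : √(t : ℝ) / 10 ^ 8 ≤ 2 * s / 10 ^ 8 := by gcongr
    linarith
  have lower' : ∀ u, t₀ ≤ u → -(5 * C) ≤ excess a (u + 1) + excess a (u + 2) := by
    intro u hu
    have h1 := lower u hu
    have h2 : (0 : ℝ) ≤ unsteadyCount a u / 1000 := by positivity
    by_contra! h3
    nlinarith
  -- Every block contains an unsteady position: a steady one would move the excess sum by s/5, more
  -- than the window from -5C to 4·10⁻⁸ s allows.
  have count : ∀ i ≤ s - 1, i ≤ unsteadyCount a (t₀ + i * s) := by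
    intro i hi
    induction i with
    | zero => exact Nat.zero_le _
    | succ i ih =>
      have hle : t₀ + (i + 1) * s + 2 ≤ t := by
        have : (i + 1) * s ≤ (s - 1) * s := Nat.mul_le_mul_right _ hi
        have h2 : (s - 1) * s + s = s * s := by
          rw [← Nat.succ_mul]; congr 1; omega
        omega
      rw [Nat.succ_mul, ← add_assoc] at hle ⊢
      rcases steady_or_lt a (t₀ + i * s) s with hst' | hlt
      · exfalso
        have h1 := abs_excess_change_of_steady hst'
        have u1 := upper (t₀ + i * s) (by omega)
        have u2 := upper (t₀ + i * s + s) hle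
        have l1 := lower' (t₀ + i * s) (by omega)
        have l2 := lower' (t₀ + i * s + s) (by omega)
        have h2 : |(excess a (t₀ + i * s + s + 1) + excess a (t₀ + i * s + s + 2)) -
            (excess a (t₀ + i * s + 1) + excess a (t₀ + i * s + 2))| ≤
            4 / 10 ^ 8 * s + 5 * C := by
          rw [abs_le]
          constructor <;> linarith
        linarith
      · have := ih (by omega)
        omega
  have hle : t₀ + (s - 1) * s + 2 ≤ t := by
    have h2 : (s - 1) * s + s = s * s := by
      rw [← Nat.succ_mul]; congr 1; omega
    omega
  have f1 := count (s - 1) le_rfl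
  have f2 : (s : ℝ) - 1 ≤ unsteadyCount a (t₀ + (s - 1) * s) := by
    have : s ≤ unsteadyCount a (t₀ + (s - 1) * s) + 1 := by omega
    have : (s : ℝ) ≤ unsteadyCount a (t₀ + (s - 1) * s) + 1 := by exact_mod_cast this
    linarith
  have f3 := lower (t₀ + (s - 1) * s) (by omega)
  have f4 := upper (t₀ + (s - 1) * s) hle
  have f5 : slope * (excess a (t₀ + (s - 1) * s + 1) + excess a (t₀ + (s - 1) * s + 2)) ≤
      4 / 10 ^ 8 * s := by
    have h0 : (0 : ℝ) ≤ 4 / 10 ^ 8 * s := by positivity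
    nlinarith
  linarith

end

/-! ### A number with prescribed digits. -/

/-- The value of `[0; a k, …, a (k + m - 1)]`. -/
noncomputable def truncTail (a : ℕ → ℕ) : ℕ → ℕ → ℝ
  | 0, _ => 0
  | m + 1, k => 1 / (a k + truncTail a m (k + 1))

lemma truncTail_nonneg (a : ℕ → ℕ) (m k : ℕ) : 0 ≤ truncTail a m k := by
  induction m generalizing k with
  | zero => exact le_rfl
  | succ m ih => rw [truncTail]; have := ih (k + 1); positivity

/-- With digits at least 4, each map y ↦ 1/(a k + y) contracts [0, ∞) by a factor 1/16. -/
lemma dist_truncTail_succ_le {a : ℕ → ℕ} (ha : ∀ k, 4 ≤ a k) (m k : ℕ) :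
    dist (truncTail a m k) (truncTail a (m + 1) k) ≤ 1 * (1 / 16) ^ m := by
  have haR : ∀ k, (4 : ℝ) ≤ a k := fun k => by exact_mod_cast ha k
  induction m generalizing k with
  | zero =>
    have := haR k
    simp only [truncTail, Real.dist_eq, zero_sub, abs_neg, add_zero, pow_zero, mul_one]
    rw [abs_of_nonneg (by positivity), div_le_one (by linarith)]
    linarith
  | succ m ih =>
    have h1 := haR k
    have h2 := truncTail_nonneg a m (k + 1)
    have h3 := truncTail_nonneg a (m + 1) (k + 1)
    have h4 := ih (k + 1)
    rw [truncTail, truncTail, Real.dist_eq]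
    rw [Real.dist_eq] at h4
    set u := truncTail a m (k + 1)
    set v := truncTail a (m + 1) (k + 1)
    have hu : 0 < (a k : ℝ) + u := by linarith
    have hv : 0 < (a k : ℝ) + v := by linarith
    rw [div_sub_div _ _ hu.ne' hv.ne', abs_div, abs_of_pos (mul_pos hu hv),
      div_le_iff₀ (mul_pos hu hv)]
    have h5 : (16 : ℝ) ≤ (a k + u) * (a k + v) := by nlinarith
    have h6 : 1 * ((a k : ℝ) + v) - (a k + u) * 1 = -(u - v) := by ring
    rw [h6, abs_neg]
    calc |u - v| ≤ 1 * (1 / 16) ^ m := h4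
      _ = 1 * (1 / 16) ^ (m + 1) * 16 := by rw [pow_succ]; ring
      _ ≤ _ := by gcongr

lemma exists_isExpansion_of_digits {a : ℕ → ℕ} (ha : ∀ k, 4 ≤ a k) :
    ∃ x X, IsExpansion x a X := by
  have hlim : ∀ k, ∃ y, Tendsto (fun m => truncTail a m k) atTop (𝓝 y) := fun k =>
    cauchySeq_tendsto_of_complete
      (cauchySeq_of_le_geometric (1 / 16) 1 (by norm_num) fun m => dist_truncTail_succ_le ha m k)
  choose X hX using hlim
  have hX0 : ∀ k, 0 ≤ X k := fun k => ge_of_tendsto' (hX k) fun m => truncTail_nonneg a m k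
  have haR : ∀ k, (4 : ℝ) ≤ a k := fun k => by exact_mod_cast ha k
  have hrec : ∀ k, X k = 1 / (a k + X (k + 1)) := fun k => by
    have h1 := (hX k).comp (tendsto_add_atTop_nat 1)
    have h2 : Tendsto (fun m => 1 / ((a k : ℝ) + truncTail a m (k + 1))) atTop
        (𝓝 (1 / (a k + X (k + 1)))) :=
      tendsto_const_nhds.div ((hX (k + 1)).const_add _)
        (by linarith [haR k, hX0 (k + 1)] : (0 : ℝ) < a k + X (k + 1)).ne'
    exact tendsto_nhds_unique h1 h2
  have hpos : ∀ k, 0 < (a k : ℝ) + X (k + 1) := fun k => by linarith [haR k, hX0 (k + 1)]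
  refine ⟨X 0, X, rfl, fun k => ⟨?_, ?_⟩, fun k => ?_, fun k => le_trans (by norm_num) (ha k)⟩
  · rw [hrec]
    exact one_div_pos.2 (hpos k)
  · rw [hrec, div_lt_one (hpos k)]
    linarith [haR k, hX0 (k + 1)]
  · rw [hrec k]
    exact one_div_mul_cancel (hpos k).ne'

/-! ### The digit sequence for (ii). -/

/-- The number of digits `5` among the first `k ^ 2` digits. -/
noncomputable def fivesAtSq (k : ℕ) : ℕ := ⌊(k : ℝ) * max 0 ((kappa2 - 4) * k - 20)⌋₊

lemma fivesAtSq_le_succ (k : ℕ) : fivesAtSq k ≤ fivesAtSq (k + 1) := by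
  have := kappa2_bounds.1
  unfold fivesAtSq
  apply Nat.floor_mono
  push_cast
  gcongr <;> linarith

/-- The new 5s fit into the 2k + 1 positions of block k, because κ₂ - 4 < 1. -/
lemma fivesAtSq_succ_le (k : ℕ) : fivesAtSq (k + 1) ≤ fivesAtSq k + (2 * k + 1) := by
  obtain ⟨h1, h2⟩ := kappa2_bounds
  have h0 : (0 : ℝ) ≤ k := Nat.cast_nonneg k
  unfold fivesAtSq
  rw [← Nat.floor_add_natCast (by positivity)]
  apply Nat.floor_mono
  push_cast
  have h3 := le_max_left 0 ((kappa2 - 4) * k - 20)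
  have h4 := le_max_right 0 ((kappa2 - 4) * k - 20)
  rcases max_cases 0 ((kappa2 - 4) * (k + 1 : ℝ) - 20) with ⟨e, -⟩ | ⟨e, -⟩ <;> rw [e]
  · rw [mul_zero]; positivity
  · nlinarith [mul_le_mul_of_nonneg_left h4 h0]

lemma le_fivesAtSq (k : ℕ) : (kappa2 - 4) * k ^ 2 - 20 * k - 1 ≤ fivesAtSq k := by
  have h1 := Nat.lt_floor_add_one ((k : ℝ) * max 0 ((kappa2 - 4) * k - 20))
  have h2 := mul_le_mul_of_nonneg_left (le_max_right 0 ((kappa2 - 4) * k - 20))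
    (Nat.cast_nonneg (α := ℝ) k)
  rw [fivesAtSq]
  linarith

lemma fivesAtSq_le {k : ℕ} (hk : 200 ≤ k) :
    (fivesAtSq k : ℝ) ≤ (kappa2 - 4) * k ^ 2 - 20 * k := by
  have h1 := kappa2_bounds.1
  have h2 : (200 : ℝ) ≤ k := by exact_mod_cast hk
  -- Here (κ₂ - 4)k ≥ 0.1 · 200 = 20, so the truncation at 0 is inactive.
  have h3 : 0 ≤ (kappa2 - 4) * k - 20 := by nlinarith
  rw [fivesAtSq, max_eq_right h3]
  refine (Nat.floor_le (by positivity)).trans (le_of_eq ?_)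
  ring

/-- The digits in positions `k ^ 2 ≤ t < (k + 1) ^ 2` are first `4`, then `5`. -/
noncomputable def blockDigit (t : ℕ) : ℕ :=
  if (Nat.sqrt t + 1) * (Nat.sqrt t + 1) + fivesAtSq (Nat.sqrt t) ≤
    t + fivesAtSq (Nat.sqrt t + 1) then 5 else 4

/-- The number of digits `5` among the first `t` digits. -/
noncomputable def fives (t : ℕ) : ℕ :=
  max (fivesAtSq (Nat.sqrt t))
    (fivesAtSq (Nat.sqrt t + 1) + t - (Nat.sqrt t + 1) * (Nat.sqrt t + 1))

lemma blockDigit_eq (t : ℕ) : blockDigit t = 4 ∨ blockDigit t = 5 := by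
  unfold blockDigit
  split_ifs <;> simp

lemma sqrt_succ_cases (t : ℕ) : Nat.sqrt (t + 1) = Nat.sqrt t ∧
      t + 1 < (Nat.sqrt t + 1) * (Nat.sqrt t + 1) ∨
    Nat.sqrt (t + 1) = Nat.sqrt t + 1 ∧ t + 1 = (Nat.sqrt t + 1) * (Nat.sqrt t + 1) := by
  have h1 : t < (Nat.sqrt t + 1) * (Nat.sqrt t + 1) := Nat.lt_succ_sqrt t
  rcases (Nat.succ_le_of_lt h1).lt_or_eq with h | h
  · left
    refine ⟨?_, h⟩
    rw [eq_comm, Nat.eq_sqrt]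
    exact ⟨(Nat.sqrt_le t).trans (Nat.le_succ t), h⟩
  · right
    refine ⟨?_, h⟩
    rw [show t + 1 = _ from h, Nat.sqrt_eq]

/-- The first entry of the `max` rules while 4s are placed; the second counts back from the end of
the block, where all remaining digits are 5. If its subtraction truncates, the first entry wins
anyway. -/
lemma fives_succ (t : ℕ) : fives (t + 1) + 4 = fives t + blockDigit t := by
  have h1 := fivesAtSq_le_succ (Nat.sqrt t)
  have h2 := fivesAtSq_succ_le (Nat.sqrt t)
  have h3 := Nat.sqrt_le t
  unfold fives blockDigit
  rcases sqrt_succ_cases t with ⟨e, h⟩ | ⟨e, h⟩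
  · rw [e]
    split_ifs <;> omega
  · have h4 := fivesAtSq_succ_le (Nat.sqrt t + 1)
    have h5 : (Nat.sqrt t + 1 + 1) * (Nat.sqrt t + 1 + 1) =
      (Nat.sqrt t + 1) * (Nat.sqrt t + 1) + 2 * (Nat.sqrt t + 1) + 1 := by ring
    rw [e]
    split_ifs <;> omega

lemma digitSum_blockDigit (t : ℕ) : digitSum blockDigit t = 4 * t + fives t := by
  induction t with
  | zero =>
    have h0 : fivesAtSq 0 = 0 := by simp [fivesAtSq]
    have h1 := fivesAtSq_succ_le 0
    have : fives 0 = 0 := by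
      unfold fives
      rw [Nat.sqrt_zero]
      omega
    rw [this]
    simp [digitSum]
  | succ t ih =>
    have := fives_succ t
    rw [digitSum_succ, ih]
    omega

lemma excess_blockDigit (t : ℕ) : excess blockDigit t = (kappa2 - 4) * t - fives t := by
  rw [excess, digitSum_blockDigit]
  push_cast
  ring

/-- Inside a block the 4s raise the excess and the 5s lower it, so it is least at the ends, where it
is at least 20k and 20(k + 1). -/
lemma le_excess_blockDigit {t : ℕ} (ht : 200 ≤ Nat.sqrt t) :
    20 * (Nat.sqrt t : ℝ) ≤ excess blockDigit t := by
  obtain ⟨k1, k2⟩ := kappa2_bounds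
  have h1 := fivesAtSq_le ht
  have h2 := fivesAtSq_le (ht.trans (Nat.le_succ _))
  have h3 : (Nat.sqrt t : ℝ) * Nat.sqrt t ≤ t := by exact_mod_cast Nat.sqrt_le t
  have h4 : (t : ℝ) < (Nat.sqrt t + 1) * (Nat.sqrt t + 1) := by exact_mod_cast Nat.lt_succ_sqrt t
  push_cast at h2
  set k : ℝ := (Nat.sqrt t : ℝ)
  have h5 : (fives t : ℝ) ≤ (kappa2 - 4) * t - 20 * k := by
    rw [fives, Nat.cast_max]
    refine max_le (by nlinarith) ?_
    by_cases hc : (Nat.sqrt t + 1) * (Nat.sqrt t + 1) ≤ fivesAtSq (Nat.sqrt t + 1) + t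
    · rw [Nat.cast_sub hc]
      push_cast
      nlinarith
    · rw [Nat.sub_eq_zero_of_le (by omega)]
      have h6 : (0 : ℝ) ≤ fivesAtSq (Nat.sqrt t) := Nat.cast_nonneg _
      push_cast
      nlinarith
  rw [excess_blockDigit]
  linarith

lemma excess_blockDigit_le {t : ℕ} (ht : 1 ≤ Nat.sqrt t) :
    excess blockDigit t ≤ 200 * √(t : ℝ) := by
  obtain ⟨k1, k2⟩ := kappa2_bounds
  have h1 := le_fivesAtSq (Nat.sqrt t)
  have h3 : (Nat.sqrt t : ℝ) * Nat.sqrt t ≤ t := by exact_mod_cast Nat.sqrt_le t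
  have h4 : (t : ℝ) < (Nat.sqrt t + 1) * (Nat.sqrt t + 1) := by exact_mod_cast Nat.lt_succ_sqrt t
  have h5 : (fivesAtSq (Nat.sqrt t) : ℝ) ≤ fives t := by exact_mod_cast le_max_left _ _
  have h6 : (Nat.sqrt t : ℝ) ≤ √(t : ℝ) := Real.le_sqrt_of_sq_le (by rw [sq]; exact h3)
  have h7 : (1 : ℝ) ≤ Nat.sqrt t := by exact_mod_cast ht
  rw [excess_blockDigit]
  nlinarith

/-! ### Growth of the denominators for the block sequence. -/

section

variable {a : ℕ → ℕ}

/-- The linear functional of two consecutive denominators that the digit `a (t + 1)` multiplies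
by `λ_{a (t + 1)}`. -/
noncomputable def eigenDen (a : ℕ → ℕ) (t : ℕ) : ℝ :=
  lam (a (t + 1)) * den a (t + 1) + den a t

lemma eigenDen_pos (ha : ∀ k, 1 ≤ a k) (t : ℕ) : 0 < eigenDen a t := by
  have p0 : (0 : ℝ) < den a t := by exact_mod_cast den_pos ha t
  have p1 : (0 : ℝ) < den a (t + 1) := by exact_mod_cast den_pos ha (t + 1)
  have := lam_pos (a (t + 1))
  rw [eigenDen]
  positivity

lemma lam_mul_eigenDen (a : ℕ → ℕ) (t : ℕ) : lam (a (t + 1)) * eigenDen a t =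
    lam (a (t + 1)) * den a (t + 2) + den a (t + 1) := by
  rw [eigenDen, den_add_two]
  push_cast
  linear_combination (den a (t + 1) : ℝ) * lam_sq (a (t + 1))

/-- The logarithmic size of `eigenDen`, compared with `2 ^ S(t)` and `excess`. -/
noncomputable def eigenEnergy (a : ℕ → ℕ) (t : ℕ) : ℝ :=
  2 * Real.log (eigenDen a t) - Real.log 2 * digitSum a (t + 1) - slope * excess a (t + 1)

/-- Digits 4 and 5 have zero defect and `eigenDen` scales exactly by λ, so the energy changes only
through replacing the coefficient λ by that of the next digit. -/
lemma eigenEnergy_succ (ha : ∀ k, a k = 4 ∨ a k = 5) (t : ℕ) : eigenEnergy a (t + 1) =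
    eigenEnergy a t + 2 * (Real.log (eigenDen a (t + 1)) -
      Real.log (lam (a (t + 1)) * eigenDen a t)) := by
  have ha1 : ∀ k, 1 ≤ a k := fun k => by rcases ha k with h | h <;> omega
  have hd : defect (a (t + 1)) = 0 := by
    rcases ha (t + 1) with h | h <;> rw [h]
    · exact defect_four
    · exact defect_five
  rw [Real.log_mul (lam_pos _).ne' (eigenDen_pos ha1 t).ne']
  rw [defect] at hd
  simp only [eigenEnergy, excess_succ a (t + 1), digitSum_succ a (t + 1)]
  push_cast
  linear_combination hd

lemma le_eigenEnergy_succ (ha : ∀ k, a k = 4 ∨ a k = 5) {t : ℕ} (h : a (t + 1) ≤ a (t + 2)) :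
    eigenEnergy a t ≤ eigenEnergy a (t + 1) := by
  have ha1 : ∀ k, 1 ≤ a k := fun k => by rcases ha k with h | h <;> omega
  have h1 : lam (a (t + 1)) * eigenDen a t ≤ eigenDen a (t + 1) := by
    rw [lam_mul_eigenDen, eigenDen]
    gcongr
    exact lam_mono h
  have := Real.log_le_log (mul_pos (lam_pos _) (eigenDen_pos ha1 t)) h1
  rw [eigenEnergy_succ ha]
  linarith

/-- Passing from λ_5 to λ_4 in the functional at worst halves it, and 2 log 2 < 2. -/
lemma sub_two_le_eigenEnergy_succ (ha : ∀ k, a k = 4 ∨ a k = 5) (t : ℕ) :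
    eigenEnergy a t - 2 ≤ eigenEnergy a (t + 1) := by
  have ha1 : ∀ k, 1 ≤ a k := fun k => by rcases ha k with h | h <;> omega
  have hp := eigenDen_pos ha1 (t + 1)
  have h1 : lam (a (t + 1)) * eigenDen a t ≤ 2 * eigenDen a (t + 1) := by
    have p1 : (0 : ℝ) < den a (t + 1) := by exact_mod_cast den_pos ha1 (t + 1)
    have p2 : (0 : ℝ) < den a (t + 2) := by exact_mod_cast den_pos ha1 (t + 2)
    have l1 : lam (a (t + 1)) ≤ lam 5 :=
      lam_mono (by rcases ha (t + 1) with h | h <;> omega)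
    have l2 : lam 4 ≤ lam (a (t + 2)) :=
      lam_mono (by rcases ha (t + 2) with h | h <;> omega)
    have l3 : lam (a (t + 1)) ≤ 2 * lam (a (t + 2)) := by
      linarith [lam_four_bounds.1, lam_five_bounds.2]
    rw [lam_mul_eigenDen, eigenDen]
    have := mul_le_mul_of_nonneg_right l3 p2.le
    linarith
  have := Real.log_le_log (mul_pos (lam_pos _) (eigenDen_pos ha1 t)) h1
  rw [Real.log_mul two_ne_zero hp.ne'] at this
  rw [eigenEnergy_succ ha]
  linarith [Real.log_two_lt_d9]

/-- The 7 bounds λ_5 + 1, and 5 log 2 pays for the one digit between S(t+1) and S(t+2). -/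
lemma le_log_den_mul_den (ha : ∀ k, a k = 4 ∨ a k = 5) (t : ℕ) :
    eigenEnergy a t + slope * excess a (t + 1) - (2 * Real.log 7 + 5 * Real.log 2) ≤
      Real.log ((den a (t + 1) * den a (t + 2) : ℝ) / 2 ^ digitSum a (t + 2)) := by
  have ha1 : ∀ k, 1 ≤ a k := fun k => by rcases ha k with h | h <;> omega
  have p0 : (0 : ℝ) < den a t := by exact_mod_cast den_pos ha1 t
  have p1 : (0 : ℝ) < den a (t + 1) := by exact_mod_cast den_pos ha1 (t + 1)
  have p2 : (0 : ℝ) < den a (t + 2) := by exact_mod_cast den_pos ha1 (t + 2)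
  have hmono : ∀ s, den a s ≤ den a (s + 1) := by
    rintro (_ | s)
    · exact ha1 0
    · rw [den_add_two]
      nlinarith [ha1 (s + 1), den_pos ha1 (s + 1)]
  have q1 : (den a t : ℝ) ≤ den a (t + 1) := by exact_mod_cast hmono t
  have q2 : (den a (t + 1) : ℝ) ≤ den a (t + 2) := by exact_mod_cast hmono (t + 1)
  have l1 : lam (a (t + 1)) ≤ lam 5 :=
    lam_mono (by rcases ha (t + 1) with h | h <;> omega)
  have h1 : eigenDen a t ≤ 7 * den a (t + 1) := by
    rw [eigenDen]
    nlinarith [lam_five_bounds.2]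
  have h2 := Real.log_le_log (eigenDen_pos ha1 t) h1
  rw [Real.log_mul (by norm_num) p1.ne'] at h2
  have h3 := Real.log_le_log p1 q2
  rw [Real.log_div (by positivity) (by positivity), Real.log_mul p1.ne' p2.ne', Real.log_pow,
    digitSum_succ a (t + 1), eigenEnergy]
  push_cast
  have h4 : (a (t + 1) : ℝ) ≤ 5 := by
    rcases ha (t + 1) with h | h <;> rw [h] <;> norm_num
  have h5 : 0 < Real.log 2 := Real.log_pos (by norm_num)
  have h6 := mul_le_mul_of_nonneg_right h4 h5.le
  linarith

end

/-- Digits do not decrease inside a block, so energy can be lost only on entering a new one; the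
square root counts these entries. -/
lemma eigenEnergy_blockDigit_ge (t : ℕ) : eigenEnergy blockDigit 0 - 2 * (Nat.sqrt (t + 1) : ℝ) ≤
    eigenEnergy blockDigit t := by
  induction t with
  | zero => linarith [Nat.cast_nonneg (α := ℝ) (Nat.sqrt (0 + 1))]
  | succ t ih =>
    rcases sqrt_succ_cases (t + 1) with ⟨e, h⟩ | ⟨e, h⟩
    · have hle : blockDigit (t + 1) ≤ blockDigit (t + 2) := by
        unfold blockDigit
        rw [show t + 2 = t + 1 + 1 from rfl, e]
        split_ifs <;> omega
      rw [e]
      exact ih.trans (le_eigenEnergy_succ blockDigit_eq hle)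
    · have := sub_two_le_eigenEnergy_succ blockDigit_eq t
      rw [e]
      push_cast
      linarith

lemma tendsto_natSqrt : Tendsto Nat.sqrt atTop atTop :=
  tendsto_atTop_atTop.2 fun b => ⟨b * b, fun _ h => Nat.le_sqrt.2 h⟩

lemma tendsto_den_mul_den_blockDigit :
    Tendsto (fun t => (den blockDigit t * den blockDigit (t + 1) : ℝ) /
      2 ^ digitSum blockDigit (t + 1)) atTop atTop := by
  rw [← tendsto_add_atTop_iff_nat 1]
  have hs : Tendsto (fun t => (Nat.sqrt (t + 1) : ℝ)) atTop atTop :=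
    tendsto_natCast_atTop_atTop.comp (tendsto_natSqrt.comp (tendsto_add_atTop_nat 1))
  have hlow := tendsto_atTop_add_const_left atTop
    (eigenEnergy blockDigit 0 - (2 * Real.log 7 + 5 * Real.log 2)) (hs.const_mul_atTop two_pos)
  refine tendsto_atTop_mono' atTop ?_ hlow
  have ha1 : ∀ k, 1 ≤ blockDigit k := fun k => by rcases blockDigit_eq k with h | h <;> omega
  filter_upwards [(tendsto_natSqrt.comp (tendsto_add_atTop_nat 1)).eventually_ge_atTop 200] with t ht
  have p1 : (0 : ℝ) < den blockDigit (t + 1) := by exact_mod_cast den_pos ha1 (t + 1)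
  have p2 : (0 : ℝ) < den blockDigit (t + 2) := by exact_mod_cast den_pos ha1 (t + 2)
  have h1 := le_log_den_mul_den blockDigit_eq t
  have h2 := eigenEnergy_blockDigit_ge t
  have h3 := le_excess_blockDigit ht
  have h4 := slope_bounds.1
  have h5 := Real.log_le_sub_one_of_pos
    (show 0 < (den blockDigit (t + 1) * den blockDigit (t + 2) : ℝ) /
      2 ^ digitSum blockDigit (t + 2) by positivity)
  -- The gain of 4k outweighs the accumulated loss of 2k, leaving 2k plus a constant.
  have h6 : 4 * (Nat.sqrt (t + 1) : ℝ) ≤ slope * excess blockDigit (t + 1) := by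
    nlinarith [Nat.cast_nonneg (α := ℝ) (Nat.sqrt (t + 1))]
  simp only [show t + 1 + 1 = t + 2 from rfl]
  linarith

end Minkowski

theorem theorem4 :
    (∀ x : ℝ, Irrational x → x ∈ Set.Ioo (0 : ℝ) 1 →
      Minkowski.HasDerivInfty Minkowski.questionMark x →
      ∀ᶠ t : ℕ in atTop,
        √(t : ℝ) / 10 ^ 8 ≤
          (Finset.range (t + 1)).sup' Finset.nonempty_range_add_one
            (fun u : ℕ => Minkowski.kappa2 * (u : ℝ) - Minkowski.partialQuotientSum x u)) ∧
    (∃ x : ℝ, Irrational x ∧ x ∈ Set.Ioo (0 : ℝ) 1 ∧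
      (∀ i : ℕ, Minkowski.partialQuotient x i = 4 ∨ Minkowski.partialQuotient x i = 5) ∧
      Minkowski.HasDerivInfty Minkowski.questionMark x ∧
      ∀ᶠ t : ℕ in atTop,
        Minkowski.kappa2 * (t : ℝ) - Minkowski.partialQuotientSum x t ≤ 200 * √(t : ℝ)) := by
  open Minkowski in
  constructor
  · intro x hx h01 hd
    obtain ⟨a, X, h⟩ := exists_isExpansion hx h01
    filter_upwards [h.eventually_exists_sqrt_le hd] with t ht
    obtain ⟨u, hu, hle⟩ := ht
    refine (Finset.le_sup'_iff _).2 ⟨u, Finset.mem_range.2 (Nat.lt_succ_of_le hu), ?_⟩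
    rw [h.partialQuotientSum_eq]
    exact hle
  · obtain ⟨x, X, h⟩ := exists_isExpansion_of_digits (a := blockDigit)
      fun k => by rcases blockDigit_eq k with h | h <;> omega
    refine ⟨x, h.irrational, h.zero ▸ h.mem 0, fun i => ?_, ?_, ?_⟩
    · rw [h.partialQuotient_eq]
      exact_mod_cast blockDigit_eq i
    · exact h.hasDerivInfty (fun k => by rcases blockDigit_eq k with h | h <;> omega)
        tendsto_den_mul_den_blockDigit
    · filter_upwards [tendsto_natSqrt.eventually_ge_atTop 1] with t ht
      rw [h.partialQuotientSum_eq]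
      exact excess_blockDigit_le ht
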